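/- For a finite graph $G$ and $\epsilon\in(0,1)$ let $cut^{\epsilon}(G)$ be the least $|S|$ over sets $S$ of vertices such that every connected component of $G-S$ has at most $\epsilon|G|$ vertices, where $|G|$ is the number of vertices of $G$. For a graph $X$ let $sep^{\epsilon}_X(n)=\sup\{cut^{\epsilon}(G): G\text{ a finite subgraph of }X,\ |G|\le n\}$. Write $f(n)\preceq g(n)$ for $f(n)=O(g(n))$ as $n\to\infty$ and $f\asymp g$ for $f\preceq g\preceq f$. Let $d\ge 2$, $b\ge 3$, $A\subseteq\{0,\dots,b-1\}$ and $0\le m\le d$. For $k\ge 0$ let $\Gamma_k(d,b,A,m)$ be the graph with vertex set $$V_k=\big\{(x_1,\dots,x_d)\in\mathbb Z^d\cap[0,b^k)^d:\ |\{i: x_{i,j}\in A\}|\le m\ \text{ for every } 0\le j<k\big\},$$ where $x_i=\sum_{j=0}^{k-1}x_{i,j}b^j$ with $x_{i,j}\in\{0,\dots,b-1\}$, two vertices being joined by an edge when their $\ell^1$-distance is $1$. Let $S(d,b,A,m)=\bigcup_{k\ge 0}\Gamma_k(d,b,A,m)$ (union of graphs). Put $$N=\sum_{i=0}^{m-1}\binom{d-1}{i}|A|^i(b-|A|)^{d-1-i}\quad(\text{with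 } 0^0=1),$$ assume that $N>0$, and let $E=\frac{\log N}{\log N+\log b}$. Then for every $\epsilon\in(0,1)$ $$sep^{\epsilon}_{S(d,b,A,m)}(n)\preceq n^{E}.$$ Moreover, if $m=1$, then $E=\frac{(d-1)\log(b-|A|)}{(d-1)\log(b-|A|)+\log b}$ and $sep^{\epsilon}_{S(d,b,A,1)}(n)\asymp n^{E}$. -/

import Mathlib

open Filter Asymptotics

noncomputable section

/-- Number of vertices of a largest connected component of a finite graph
(`0` for the graph without vertices). -/
def largestComponentCard {V : Type*} (G : SimpleGraph V) : ℕ :=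
  ⨆ c : G.ConnectedComponent, c.supp.ncard

/-- `cut^ε(G)` for a finite graph `G`: the least size of a set `S` of vertices such that every
connected component of `G - S` has at most `ε |G|` vertices. The set of admissible sizes contains
`|G|`, so the infimum is a minimum. -/
def cutSize {V : Type*} (ε : ℝ) (G : SimpleGraph V) : ℕ :=
  sInf {s : ℕ | ∃ S : Set V, S.ncard = s ∧
    (largestComponentCard (G.induce Sᶜ) : ℝ) ≤ ε * (Nat.card V : ℝ)}

/-- The `ε`-separation profile of `X`: the supremum of `cut^ε(G)` over the (not necessarily
induced) finite subgraphs `G` of `X` with at most `n` vertices. The set is bounded by `n`. -/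
def sepProfile {V : Type*} (ε : ℝ) (X : SimpleGraph V) (n : ℕ) : ℕ :=
  sSup {c : ℕ | ∃ G : X.Subgraph, G.verts.Finite ∧ G.verts.ncard ≤ n ∧ c = cutSize ε G.coe}

/-- The integer lattice graph on the orthant `ℤ^d ∩ [0, ∞)^d`: two points are adjacent when their
`ℓ¹`-distance is `1`. -/
def orthantGraph (d : ℕ) : SimpleGraph (Fin d → ℕ) where
  Adj x y := ∑ i, |(x i : ℤ) - (y i : ℤ)| = 1
  symm := ⟨fun x y h => by simpa only [abs_sub_comm] using h⟩
  loopless := ⟨fun x h => by simp at h⟩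

/-- The vertex set `V_k`: points of `[0, b^k)^d` such that, for each of the `k` digit positions
`j < k`, at most `m` coordinates have their `j`-th base-`b` digit in `A`. Leading zeros among the
first `k` digits count as digits. -/
def spongeVerts (d b : ℕ) (A : Finset ℕ) (m k : ℕ) : Set (Fin d → ℕ) :=
  {x | (∀ i, x i < b ^ k) ∧
    ∀ j < k, (Finset.univ.filter fun i => x i / b ^ j % b ∈ A).card ≤ m}

/-- The graph `Γ_k(d, b, A, m)`: the lattice graph induced on `V_k`. -/
def spongeLevel (d b : ℕ) (A : Finset ℕ) (m k : ℕ) : (orthantGraph d).Subgraph :=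
  (⊤ : (orthantGraph d).Subgraph).induce (spongeVerts d b A m k)

/-- The graph `S(d, b, A, m)`, the union over `k` of the graphs `Γ_k(d, b, A, m)`. -/
def sponge (d b : ℕ) (A : Finset ℕ) (m : ℕ) : (orthantGraph d).Subgraph :=
  ⨆ k : ℕ, spongeLevel d b A m k

/-- `N = ∑_{i=0}^{m-1} C(d-1, i) |A|^i (b - |A|)^{d-1-i}`. -/
def spongeN (d b : ℕ) (A : Finset ℕ) (m : ℕ) : ℕ :=
  ∑ i ∈ Finset.range m, (d - 1).choose i * A.card ^ i * (b - A.card) ^ (d - 1 - i)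

/-- `E = log N / (log N + log b)`. -/
def spongeE (d b : ℕ) (A : Finset ℕ) (m : ℕ) : ℝ :=
  Real.log (spongeN d b A m) / (Real.log (spongeN d b A m) + Real.log b)

end

/-! ### Separators, labelled pieces and greedy cutting. -/

section Separators

variable {V : Type*}

/-! Upper bound. Fix a digit a, in A if A is nonempty, and consider the hyperplanes on which one
coordinate ends in j digits a. They bound boxes of side b^j, nested as j grows. A coordinate with
digit a leaves at most N choices for the other d - 1 digits at that position, so the faces of such a
box carry only O(N^j) sponge points. Let G have n ≤ (bN)^k vertices. By pigeonhole some shifted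
hyperplanes of spacing b^k contain at most N^k vertices of G in each direction; delete these. While
some box of side at most b^k holds more than t ≈ εn/2^d remaining vertices, take one of least side
and delete its faces and those of its children: O(N^k) deletions isolate it and leave light pieces
(`exists_isolating_separator`). This happens O(2^d/ε) times. Once all boxes are light, a shifted box
meets at most 2^d of them, so it holds at most εn vertices. The total is O(N^k), and (bN)^E = N
turns this into O(n^E).

Lower bound, m = 1. Let C be the numbers below b^k with no digit in A. The points with all
coordinates but one in C form a union of full axis-parallel lines, with about b^k |C|^(d-1) = (bN)^k
vertices. A deleted point blocks at most one line per direction, so an averaging argument over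
axis-parallel paths between points of C^d shows that deleting S leaves one component missing only
O(|S| b^k) points (`card_le_largestComponentCard_add`). Hence |S| must be at least of order N^k. -/

lemma cutSize_le_of_label [Finite V] {ι : Type*} {G : SimpleGraph V} {ε : ℝ} {L : ℕ} (S : Set V)
    (f : V → ι) (hf : ∀ u v, G.Adj u v → u ∉ S → v ∉ S → f u = f v)
    (hL : ∀ c, {v | v ∉ S ∧ f v = c}.ncard ≤ L) (hε : (L : ℝ) ≤ ε * (Nat.card V : ℝ)) :
    cutSize ε G ≤ S.ncard := by
  refine Nat.sInf_le ⟨S, rfl, le_trans ?_ hε⟩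
  refine Nat.cast_le.2 (ciSup_le' fun c => ?_)
  obtain ⟨u, rfl⟩ := c.exists_rep
  have hlab : ∀ v, (G.induce Sᶜ).Reachable u v → f u = f v := by
    rintro v ⟨p⟩
    induction p with
    | nil => rfl
    | @cons x y z h p ih => exact (hf _ _ h x.2 y.2).trans ih
  refine le_trans ?_ (hL (f u))
  rw [← Set.ncard_image_of_injective _ (Subtype.val_injective (p := fun v => v ∈ Sᶜ))]
  refine Set.ncard_le_ncard ?_ (Set.toFinite _)
  rintro _ ⟨v, hv, rfl⟩
  refine ⟨v.2, (hlab v ?_).symm⟩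
  have : (G.induce Sᶜ).connectedComponentMk v = (G.induce Sᶜ).connectedComponentMk u := hv
  exact (SimpleGraph.ConnectedComponent.exact this).symm

/-- Removing `S` splits `W` into parts of size at most `L`: there is a labelling of the vertices
that is constant along the edges of `W \ S` and whose fibres in `W \ S` have size at most `L`. -/
def SplitsInto [DecidableEq V] (G : SimpleGraph V) (W S : Finset V) (L : ℕ) : Prop :=
  ∃ (ι : Type) (f : V → ι),
    (∀ u ∈ W \ S, ∀ v ∈ W \ S, G.Adj u v → f u = f v) ∧
    ∀ F ⊆ W \ S, (∀ u ∈ F, ∀ v ∈ F, f u = f v) → F.card ≤ L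

lemma cutSize_le_of_splitsInto [Fintype V] [DecidableEq V] {G : SimpleGraph V} {ε : ℝ} {L : ℕ}
    {S : Finset V} (h : SplitsInto G Finset.univ S L) (hε : (L : ℝ) ≤ ε * (Nat.card V : ℝ)) :
    cutSize ε G ≤ S.card := by
  classical
  obtain ⟨ι, f, hf, hF⟩ := h
  rw [← Set.ncard_coe_finset]
  refine cutSize_le_of_label (S : Set V) f (fun u v huv hu hv => ?_) (fun c => ?_) hε
  · exact hf u (by simpa using hu) v (by simpa using hv) huv
  · have := hF (Finset.univ.filter fun v => v ∉ S ∧ f v = c) (fun v hv => by simp at hv; simp [hv.1])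
      (fun u hu v hv => by simp at hu hv; rw [hu.2, hv.2])
    rw [← Set.ncard_coe_finset] at this
    simpa using this

/-- If every vertex set either has only small parts or contains a large isolated piece that can be
split at cost `K`, then `r` such steps exhaust any set of at most `r * (t + 1)` vertices. -/
lemma exists_splitsInto_of_greedy [DecidableEq V] {G : SimpleGraph V} {L K t : ℕ} {W₀ : Finset V}
    (h : ∀ W ⊆ W₀, SplitsInto G W ∅ L ∨ ∃ S Q : Finset V, S.card ≤ K ∧ Q ⊆ W ∧ t < Q.card ∧
      (∀ u ∈ Q \ S, ∀ v ∈ W \ S, G.Adj u v → v ∈ Q) ∧ SplitsInto G Q S L) (r : ℕ) :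
    ∀ W ⊆ W₀, W.card ≤ r * (t + 1) → ∃ S : Finset V, S.card ≤ r * K ∧ SplitsInto G W S L := by
  induction r with
  | zero =>
    intro W _ hc
    have : W = ∅ := by simpa using hc
    subst this
    exact ⟨∅, by simp, Unit, fun _ => (), by simp, fun F hF _ => by
      have : F = ∅ := by simpa using hF
      simp [this]⟩
  | succ r ih =>
    intro W hW hc
    rcases h W hW with h0 | ⟨S, Q, hS, hQ, ht, hQW, ι, f, hf, hfL⟩
    · exact ⟨∅, by simp, h0⟩
    obtain ⟨S', hS', κ, g, hg, hgL⟩ := ih (W \ Q) (Finset.sdiff_subset.trans hW) (by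
      rw [Finset.card_sdiff_of_subset hQ]
      have : (r + 1) * (t + 1) = r * (t + 1) + (t + 1) := by ring
      omega)
    -- The sum type keeps labels inside and outside Q apart; this is consistent because no edge
    -- leaves Q once S is deleted.
    refine ⟨S ∪ S', (Finset.card_union_le _ _).trans (by rw [Nat.add_mul]; omega), ι ⊕ κ,
      fun v => if v ∈ Q then Sum.inl (f v) else Sum.inr (g v), ?_, ?_⟩
    · intro u hu v hv huv
      simp only [Finset.mem_sdiff, Finset.mem_union, not_or] at hu hv
      by_cases hq : u ∈ Q
      · have hq' : v ∈ Q := hQW u (by simp [hq, hu]) v (by simp [hv]) huv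
        simp only [hq, hq', if_true]
        rw [hf u (by simp [hq, hu]) v (by simp [hq', hv]) huv]
      · have hq' : v ∉ Q := fun hq' => hq (hQW v (by simp [hq', hv]) u (by simp [hu]) huv.symm)
        simp only [hq, hq', if_false]
        rw [hg u (by simp [hq, hu]) v (by simp [hq', hv]) huv]
    · intro F hF hc
      rcases F.eq_empty_or_nonempty with rfl | ⟨w, hw⟩
      · simp
      have hF' : ∀ v ∈ F, v ∈ W ∧ v ∉ S ∧ v ∉ S' := fun v hv => by simpa using hF hv
      by_cases hq : w ∈ Q
      · have hall : ∀ v ∈ F, v ∈ Q := fun v hv => by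
          by_contra hn
          simpa [hq, hn] using hc w hw v hv
        refine hfL F (fun v hv => by simp [hall v hv, hF' v hv]) fun u hu v hv => ?_
        simpa [hall u hu, hall v hv] using hc u hu v hv
      · have hall : ∀ v ∈ F, v ∉ Q := fun v hv hn => by
          simpa [hq, hn] using hc w hw v hv
        refine hgL F (fun v hv => by simp [hall v hv, hF' v hv]) fun u hu v hv => ?_
        simpa [hall u hu, hall v hv] using hc u hu v hv

end Separators

/-! ### Counting sponge points on a hyperplane. -/

section Counting

variable {d b m : ℕ} {A : Finset ℕ}

/-- The number with `j` base-`b` digits, all equal to `a`. -/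
def repdigit (a b j : ℕ) : ℕ := a * ∑ i ∈ Finset.range j, b ^ i

lemma repdigit_succ (a b j : ℕ) : repdigit a b (j + 1) = a * b ^ j + repdigit a b j := by
  rw [repdigit, Finset.sum_range_succ, repdigit]; ring

lemma repdigit_succ_eq_mul_add (a b j : ℕ) : repdigit a b (j + 1) = b * repdigit a b j + a := by
  rw [repdigit, Finset.sum_range_succ', repdigit]
  simp only [pow_succ, ← Finset.sum_mul]; ring

lemma repdigit_lt {a b : ℕ} (ha : a < b) (j : ℕ) : repdigit a b j < b ^ j := by
  induction j with
  | zero => simp [repdigit]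
  | succ j ih =>
    rw [repdigit_succ, pow_succ]
    have : (a + 1) * b ^ j ≤ b ^ j * b := by rw [mul_comm]; gcongr; omega
    nlinarith

lemma repdigit_mod {a b : ℕ} (ha : a < b) {i j : ℕ} (h : i ≤ j) :
    repdigit a b j % b ^ i = repdigit a b i := by
  induction j, h using Nat.le_induction with
  | base => exact Nat.mod_eq_of_lt (repdigit_lt ha i)
  | succ j hj ih =>
    rw [repdigit_succ, Nat.add_mod, ih, Nat.mod_eq_zero_of_dvd ((pow_dvd_pow b hj).mul_left a),
      zero_add, Nat.mod_eq_of_lt (repdigit_lt ha i)]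

lemma mod_pow_digit {b t j : ℕ} (x : ℕ) (h : t < j) : x % b ^ j / b ^ t % b = x / b ^ t % b := by
  obtain ⟨r, rfl⟩ := Nat.exists_eq_add_of_lt h
  rw [show b ^ (t + r + 1) = b ^ t * (b * b ^ r) by ring, Nat.mod_mul_right_div_self,
    Nat.mod_mul_right_mod]

lemma mod_pow_mem_spongeVerts (hb : 0 < b) {j K : ℕ} (h : j ≤ K) {x : Fin d → ℕ}
    (hx : x ∈ spongeVerts d b A m K) : (fun i => x i % b ^ j) ∈ spongeVerts d b A m j := by
  refine ⟨fun i => Nat.mod_lt _ (by positivity), fun t ht => ?_⟩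
  simp only [mod_pow_digit _ ht]
  exact hx.2 t (ht.trans_le h)

lemma div_mem_spongeVerts {k : ℕ} {x : Fin d → ℕ} (hx : x ∈ spongeVerts d b A m (k + 1)) :
    (fun i => x i / b) ∈ spongeVerts d b A m k := by
  refine ⟨fun i => Nat.div_lt_of_lt_mul (by rw [← pow_succ']; exact hx.1 i), fun t ht => ?_⟩
  simp only [Nat.div_div_eq_div_mul, ← pow_succ']
  exact hx.2 (t + 1) (by omega)

/-- The vectors of digits with at most `m` entries in `A` and entry `a` at `i₀`. -/
def digitSlice (d b : ℕ) (A : Finset ℕ) (m a : ℕ) (i₀ : Fin d) : Finset (Fin d → ℕ) :=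
  (Fintype.piFinset fun _ => Finset.range b).filter fun y =>
    y i₀ = a ∧ (Finset.univ.filter fun i => y i ∈ A).card ≤ m

/-- Splitting off the lowest digit leaves the same problem with one digit fewer, and the digits
split off form a vector in `digitSlice`: a factor N per position. -/
lemma card_slice_le (hb : 0 < b) {a N : ℕ} (ha : a < b) {i₀ : Fin d}
    (hN : (digitSlice d b A m a i₀).card ≤ N) (j : ℕ) :
    ∀ X : Finset (Fin d → ℕ),
      (∀ x ∈ X, x ∈ spongeVerts d b A m j ∧ x i₀ = repdigit a b j) → X.card ≤ N ^ j := by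
  induction j with
  | zero =>
    intro X hX
    rw [pow_zero, Finset.card_le_one]
    intro x hx y hy
    funext i
    have h1 := (hX x hx).1.1 i
    have h2 := (hX y hy).1.1 i
    simp at h1 h2; omega
  | succ j ih =>
    intro X hX
    have h1 : (X.image fun x i => x i / b).card ≤ N ^ j := by
      refine ih _ fun y hy => ?_
      obtain ⟨x, hx, rfl⟩ := Finset.mem_image.1 hy
      refine ⟨div_mem_spongeVerts (hX x hx).1, ?_⟩
      simp only [(hX x hx).2, repdigit_succ_eq_mul_add]
      rw [Nat.mul_add_div hb, Nat.div_eq_of_lt ha, add_zero]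
    have h2 : X.card ≤ N * (X.image fun x i => x i / b).card := by
      refine Finset.card_le_mul_card_image X N fun p _ => le_trans ?_ hN
      refine Finset.card_le_card_of_injOn (fun x i => x i % b) (fun x hx => ?_) ?_
      · simp only [Finset.coe_filter, Set.mem_ofPred_eq] at hx
        have h0 := (hX x hx.1).1.2 0 (by omega)
        simp only [pow_zero, Nat.div_one] at h0
        simp only [digitSlice, Finset.coe_filter, Fintype.mem_piFinset, Finset.mem_range,
          Set.mem_ofPred_eq]
        refine ⟨fun i => Nat.mod_lt _ hb, ?_, h0⟩
        rw [(hX x hx.1).2, repdigit_succ_eq_mul_add, Nat.mul_add_mod, Nat.mod_eq_of_lt ha]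
      · intro x hx y hy hxy
        simp only [Finset.coe_filter, Set.mem_ofPred_eq] at hx hy
        funext i
        have e1 : x i / b = y i / b := (congrFun hx.2 i).trans (congrFun hy.2 i).symm
        have e2 : x i % b = y i % b := congrFun hxy i
        rw [← Nat.div_add_mod (x i) b, ← Nat.div_add_mod (y i) b, e1, e2]
    calc X.card ≤ _ := h2
      _ ≤ N * N ^ j := by gcongr
      _ = N ^ (j + 1) := by ring

/-- Inside a standard b-adic cell the last j digits determine the point. At a level K < j only K
digits exist, hence the minimum. -/
lemma card_cell_slice_le (hb : 0 < b) {a N : ℕ} (ha : a < b) {i₀ : Fin d} (hN0 : 0 < N)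
    (hN : (digitSlice d b A m a i₀).card ≤ N) (j K : ℕ) (p : Fin d → ℕ) (X : Finset (Fin d → ℕ))
    (hX : ∀ x ∈ X, x ∈ spongeVerts d b A m K ∧ (∀ i, x i / b ^ j = p i) ∧
      x i₀ % b ^ j = repdigit a b j) : X.card ≤ N ^ j := by
  set j₀ := min j K
  have hj : j₀ ≤ j := min_le_left _ _
  have hinj : Set.InjOn (fun (x : Fin d → ℕ) i => x i % b ^ j₀) X := by
    intro x hx y hy hxy
    funext i
    have e2 : x i % b ^ j₀ = y i % b ^ j₀ := congrFun hxy i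
    rcases le_total j K with h | h
    · have : j₀ = j := min_eq_left h
      rw [this] at e2
      rw [← Nat.div_add_mod (x i) (b ^ j), ← Nat.div_add_mod (y i) (b ^ j), e2,
        (hX x hx).2.1 i, (hX y hy).2.1 i]
    · have : j₀ = K := min_eq_right h
      rwa [this, Nat.mod_eq_of_lt ((hX x hx).1.1 i), Nat.mod_eq_of_lt ((hX y hy).1.1 i)] at e2
  rw [← Finset.card_image_of_injOn hinj]
  refine (card_slice_le hb ha hN j₀ _ fun y hy => ?_).trans (Nat.pow_le_pow_right hN0 hj)
  obtain ⟨x, hx, rfl⟩ := Finset.mem_image.1 hy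
  refine ⟨mod_pow_mem_spongeVerts hb (min_le_right _ _) (hX x hx).1, ?_⟩
  simp only
  rw [← Nat.mod_mod_of_dvd _ (pow_dvd_pow b hj), (hX x hx).2.2, repdigit_mod ha hj]

lemma card_filter_card_mem_eq {ι : Type*} [Fintype ι] [DecidableEq ι] (hA : A ⊆ Finset.range b)
    (k : ℕ) :
    ((Fintype.piFinset fun _ : ι => Finset.range b).filter fun y =>
      (Finset.univ.filter fun i => y i ∈ A).card = k).card =
    (Fintype.card ι).choose k * A.card ^ k * (b - A.card) ^ (Fintype.card ι - k) := by
  have h : ((Fintype.piFinset fun _ : ι => Finset.range b).filter fun y =>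
      (Finset.univ.filter fun i => y i ∈ A).card = k) =
      (Finset.univ.powersetCard k).biUnion fun I : Finset ι =>
        Fintype.piFinset fun i => if i ∈ I then A else Finset.range b \ A := by
    ext y
    simp only [Finset.mem_filter, Fintype.mem_piFinset, Finset.mem_biUnion,
      Finset.mem_powersetCard, Finset.subset_univ, true_and]
    constructor
    · rintro ⟨h1, h2⟩
      refine ⟨_, h2, fun i => ?_⟩
      by_cases h : y i ∈ A
      · simp [h]
      · simpa [h] using h1 i
    · rintro ⟨I, rfl, hI⟩
      have key : ∀ i, y i ∈ A ↔ i ∈ I := fun i => by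
        have := hI i
        by_cases h : i ∈ I
        · simpa [h] using this
        · simp only [h, if_false, Finset.mem_sdiff] at this
          simp [h, this.2]
      refine ⟨fun i => ?_, by simp [key]⟩
      have := hI i
      by_cases h : i ∈ I
      · simp only [h, if_true] at this; exact hA this
      · simp only [h, if_false, Finset.mem_sdiff] at this; exact this.1
  rw [h, Finset.card_biUnion]
  · rw [Finset.sum_congr rfl (g := fun _ => A.card ^ k * (b - A.card) ^ (Fintype.card ι - k))]
    · simp [Finset.card_powersetCard, Finset.card_univ, mul_assoc]
    · intro I hI
      have hI := (Finset.mem_powersetCard.1 hI).2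
      rw [Fintype.card_piFinset]
      simp only [apply_ite Finset.card]
      rw [Finset.prod_ite, Finset.prod_const, Finset.prod_const, Finset.card_sdiff_of_subset hA,
        Finset.card_range]
      have e : (Finset.univ.filter fun i => i ∈ I) = I := by ext; simp
      have e' : (Finset.univ.filter fun i => i ∉ I) = Iᶜ := by ext; simp
      rw [e, e', Finset.card_compl, hI]
  · intro I _ J _ hIJ
    rw [Function.onFun, Finset.disjoint_left]
    intro y hy hy'
    refine hIJ (Finset.ext fun i => ?_)
    have h1 := Fintype.mem_piFinset.1 hy i
    have h2 := Fintype.mem_piFinset.1 hy' i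
    by_cases hi : i ∈ I <;> by_cases hj : i ∈ J <;> simp_all

lemma card_filter_card_mem_lt {ι : Type*} [Fintype ι] [DecidableEq ι] (hA : A ⊆ Finset.range b) :
    ((Fintype.piFinset fun _ : ι => Finset.range b).filter fun y =>
      (Finset.univ.filter fun i => y i ∈ A).card < m).card =
    ∑ k ∈ Finset.range m,
      (Fintype.card ι).choose k * A.card ^ k * (b - A.card) ^ (Fintype.card ι - k) := by
  rw [Finset.card_eq_sum_card_fiberwise
    (f := fun y : ι → ℕ => (Finset.univ.filter fun i => y i ∈ A).card) (t := Finset.range m)]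
  · refine Finset.sum_congr rfl fun k hk => ?_
    rw [← card_filter_card_mem_eq hA, Finset.filter_filter]
    congr 1
    ext y
    simp only [Finset.mem_filter, Finset.mem_range] at hk ⊢
    grind
  · intro y hy
    simp at hy ⊢
    exact hy.2

/-- The source of N: for a ∈ A the fixed coordinate uses one of the m permitted entries, so fewer
than m of the others lie in A. If A is empty any digit works, since N > 0 forces m > 0. -/
lemma exists_digit_card_digitSlice_le (hb : 0 < b) (hA : A ⊆ Finset.range b)
    (hN : 0 < spongeN d b A m) :
    ∃ a < b, ∀ i₀ : Fin d, (digitSlice d b A m a i₀).card ≤ spongeN d b A m := by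
  have hm : 0 < m := by
    rcases Nat.eq_zero_or_pos m with rfl | h
    · simp [spongeN] at hN
    · exact h
  have key : ∃ a < b, a ∈ A ∨ A = ∅ := by
    rcases A.eq_empty_or_nonempty with h | ⟨a, ha⟩
    · exact ⟨0, hb, Or.inr h⟩
    · exact ⟨a, Finset.mem_range.1 (hA ha), Or.inl ha⟩
  obtain ⟨a, hab, ha⟩ := key
  refine ⟨a, hab, fun i₀ => ?_⟩
  have hc : Fintype.card {i // i ≠ i₀} = d - 1 := by simp [Fintype.card_subtype_compl]
  rw [spongeN, ← hc, ← card_filter_card_mem_lt hA]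
  refine Finset.card_le_card_of_injOn (fun y i => y i.1) (fun y hy => ?_) ?_
  · simp only [digitSlice, Finset.coe_filter, Fintype.mem_piFinset, Finset.mem_range,
      Set.mem_ofPred_eq] at hy ⊢
    refine ⟨fun i => hy.1 i.1, ?_⟩
    rcases ha with ha | rfl
    · refine lt_of_lt_of_le ?_ hy.2.2
      rw [← Finset.card_map (Function.Embedding.subtype _)]
      refine Finset.card_lt_card (Finset.ssubset_iff_of_subset ?_ |>.2 ⟨i₀, ?_, ?_⟩)
      · intro i hi
        simp at hi
        simpa using hi.1
      · simp [hy.2.1, ha]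
      · simp
    · simpa using hm
  · intro y hy z hz hyz
    simp only [digitSlice, Finset.coe_filter, Set.mem_ofPred_eq] at hy hz
    funext i
    by_cases h : i = i₀
    · rw [h, hy.2.1, hz.2.1]
    · exact congrFun hyz ⟨i, h⟩

end Counting

/-! ### Shifted boxes and their faces. -/

section UpperBound

variable {d b m : ℕ} {A : Finset ℕ}

lemma orthantGraph_adj_iff {x y : Fin d → ℕ} :
    (orthantGraph d).Adj x y ↔ ∃ i, (y i = x i + 1 ∨ x i = y i + 1) ∧ ∀ j ≠ i, x j = y j := by
  change (∑ i, |(x i : ℤ) - (y i : ℤ)| = 1) ↔ _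
  constructor
  · intro h
    have hne : ∃ i, x i ≠ y i := by
      by_contra! hn
      simp [hn] at h
    obtain ⟨i, hi⟩ := hne
    rw [← Finset.add_sum_erase _ _ (Finset.mem_univ i)] at h
    have h1 : 0 < |(x i : ℤ) - (y i : ℤ)| := abs_pos.2 (by omega)
    have h2 : 0 ≤ ∑ j ∈ Finset.univ.erase i, |(x j : ℤ) - (y j : ℤ)| :=
      Finset.sum_nonneg fun _ _ => abs_nonneg _
    have h3 : ∑ j ∈ Finset.univ.erase i, |(x j : ℤ) - (y j : ℤ)| = 0 := by omega
    have h4 : |(x i : ℤ) - (y i : ℤ)| = 1 := by omega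
    refine ⟨i, ?_, fun j hj => ?_⟩
    · rcases abs_eq (by norm_num : (0 : ℤ) ≤ 1) |>.1 h4 with h | h <;> omega
    · have := (Finset.sum_eq_zero_iff_of_nonneg fun _ _ => abs_nonneg _).1 h3 j (by simp [hj])
      rw [abs_eq_zero] at this
      omega
  · rintro ⟨i, hi, hj⟩
    rw [Finset.sum_eq_single i]
    · rcases hi with h | h <;> simp [h]
    · intro j _ hji
      simp [hj j hji]
    · simp

/-- The index of the box of side `B`, shifted by `-s`, that contains `x`. -/
def boxIndex (B : ℕ) (s : Fin d → ℕ) (x : Fin d → ℕ) : Fin d → ℕ := fun i => (x i + s i) / B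

/-- An edge between two boxes has its larger endpoint on a lower face, so deleting lower faces alone
separates boxes. -/
lemma boxIndex_eq_or_of_adj {B : ℕ} {s x y : Fin d → ℕ} (h : (orthantGraph d).Adj x y) :
    boxIndex B s x = boxIndex B s y ∨
      ∃ i, (∀ j ≠ i, x j = y j) ∧
        (y i = x i + 1 ∧ B ∣ y i + s i ∨ x i = y i + 1 ∧ B ∣ x i + s i) := by
  obtain ⟨i, hi, hj⟩ := orthantGraph_adj_iff.1 h
  by_cases he : (x i + s i) / B = (y i + s i) / B
  · left
    funext j
    by_cases hji : j = i
    · subst hji; exact he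
    · simp only [boxIndex, hj j hji]
  · refine Or.inr ⟨i, hj, ?_⟩
    rcases hi with hi | hi
    · refine Or.inl ⟨hi, ?_⟩
      rw [hi, add_right_comm, Nat.succ_div] at he
      rw [hi, add_right_comm]
      by_contra hn
      simp [hn] at he
    · refine Or.inr ⟨hi, ?_⟩
      rw [hi, add_right_comm, Nat.succ_div] at he
      rw [hi, add_right_comm]
      by_contra hn
      simp [hn] at he

/-- The shift whose boxes of side `b ^ j` begin at the numbers `≡ repdigit a b j`. -/
def repShift (a b j : ℕ) : ℕ := b ^ j - repdigit a b j

lemma mod_eq_of_dvd_add_sub {B r x : ℕ} (hr : r < B) (h : B ∣ x + (B - r)) : x % B = r := by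
  have h1 : x + (B - r) + r ≡ 0 + r [MOD B] :=
    Nat.ModEq.add_right r ((Nat.modEq_zero_iff_dvd).2 h)
  have h2 : x + (B - r) + r = x + B := by omega
  rw [h2, zero_add] at h1
  have h3 : x % B = r % B := by simpa [Nat.ModEq] using h1
  rw [h3, Nat.mod_eq_of_lt hr]

lemma repShift_succ {a b : ℕ} (ha : a < b) (j : ℕ) :
    repShift a b (j + 1) = (b - 1 - a) * b ^ j + repShift a b j := by
  have h := repdigit_lt ha j
  rw [repShift, repShift, repdigit_succ, pow_succ]
  obtain ⟨c, rfl⟩ := Nat.exists_eq_add_of_lt ha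
  have e : a + c + 1 - 1 - a = c := by omega
  rw [e]
  have : (a + c + 1) ^ j * (a + c + 1) =
    a * (a + c + 1) ^ j + c * (a + c + 1) ^ j + (a + c + 1) ^ j := by ring
  omega

/-- Nesting of the boxes: the index at scale j + 1 is a function of the index at scale j. -/
lemma add_repShift_succ_div {a b : ℕ} (ha : a < b) (j x : ℕ) :
    (x + repShift a b (j + 1)) / b ^ (j + 1) =
      ((x + repShift a b j) / b ^ j + (b - 1 - a)) / b := by
  have hb : 0 < b ^ j := Nat.pow_pos (by omega)
  rw [repShift_succ ha, pow_succ, ← Nat.div_div_eq_div_mul,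
    show x + ((b - 1 - a) * b ^ j + repShift a b j) =
      x + repShift a b j + (b - 1 - a) * b ^ j by ring, Nat.add_mul_div_right _ _ hb]

/-- The numbers `y / B` for `y` in an interval of length `c * B` take at most `c + 1` values. -/
lemma div_mem_Icc_of_le {B c y₀ y : ℕ} (hB : 0 < B) (h1 : y₀ ≤ y) (h2 : y ≤ y₀ + c * B) :
    y / B ∈ Finset.Icc (y₀ / B) (y₀ / B + c) := by
  rw [Finset.mem_Icc]
  refine ⟨Nat.div_le_div_right h1, ?_⟩
  rw [← Nat.add_mul_div_right _ _ hB]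
  exact Nat.div_le_div_right h2

variable {V : Type*}

/-- A closed box of side b * b^j meets at most (b + 1)^d standard cells of side b^j, and each cell
contains one admissible slice in each of the d directions. -/
lemma card_separator_le [Fintype V] [DecidableEq V] (hb : 0 < b) {a N : ℕ} (ha : a < b)
    (hN0 : 0 < N) (hN : ∀ i₀ : Fin d, (digitSlice d b A m a i₀).card ≤ N)
    {pos : V → Fin d → ℕ} (hpos : Function.Injective pos) (j K : ℕ) (q : Fin d → ℕ) (S : Finset V)
    (hS : ∀ v ∈ S, pos v ∈ spongeVerts d b A m K ∧
      (∀ i, q i ≤ pos v i ∧ pos v i ≤ q i + b * b ^ j) ∧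
      ∃ i, b ^ j ∣ pos v i + repShift a b j) :
    S.card ≤ d * (b + 1) ^ d * N ^ j := by
  classical
  have hB : 0 < b ^ j := by positivity
  set P : Finset (Fin d → ℕ) :=
    Fintype.piFinset fun i => Finset.Icc (q i / b ^ j) (q i / b ^ j + b)
  have hP : P.card = (b + 1) ^ d := by
    rw [Fintype.card_piFinset]
    have : ∀ x : ℕ, x + b + 1 - x = b + 1 := fun x => by omega
    simp [this]
  have hsub : S ⊆ ((Finset.univ : Finset (Fin d)) ×ˢ P).biUnion fun ip =>
      S.filter fun v => (∀ i, pos v i / b ^ j = ip.2 i) ∧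
        pos v ip.1 % b ^ j = repdigit a b j := by
    intro v hv
    obtain ⟨h1, h2, i, hi⟩ := hS v hv
    simp only [Finset.mem_biUnion, Finset.mem_filter, Finset.mem_product, Finset.mem_univ, true_and]
    refine ⟨(i, fun i => pos v i / b ^ j), ?_, hv, fun _ => rfl, ?_⟩
    · exact Fintype.mem_piFinset.2 fun i => div_mem_Icc_of_le hB (h2 i).1 (h2 i).2
    · exact mod_eq_of_dvd_add_sub (repdigit_lt ha j) hi
  refine (Finset.card_le_card hsub).trans ?_
  refine (Finset.card_biUnion_le_card_mul _ _ (N ^ j) fun ip _ => ?_).trans_eq ?_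
  · rw [← Finset.card_image_of_injective _ hpos]
    refine card_cell_slice_le hb ha hN0 (hN ip.1) j K ip.2 _ fun x hx => ?_
    simp only [Finset.mem_image, Finset.mem_filter] at hx
    obtain ⟨v, ⟨hv, h1, h2⟩, rfl⟩ := hx
    exact ⟨(hS v hv).1, h1, h2⟩
  · rw [Finset.card_product, hP]; simp

lemma exists_shift_card_le [Fintype V] {B M : ℕ} (hB : 0 < B) (hV : Fintype.card V ≤ B * M)
    (f : V → ℕ) : ∃ s ≤ B, (Finset.univ.filter fun v => B ∣ f v + s).card ≤ M := by
  obtain ⟨r, hr, h⟩ := Finset.exists_card_fiber_le_of_card_le_mul (s := (Finset.univ : Finset V))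
    (t := Finset.range B) (f := fun v => f v % B) (n := M) (by simpa using hB.ne') (by simpa using hV)
  refine ⟨B - r, Nat.sub_le _ _, (Finset.card_le_card fun v hv => ?_).trans h⟩
  simp only [Finset.mem_filter, Finset.mem_univ, true_and] at hv ⊢
  exact mod_eq_of_dvd_add_sub (Finset.mem_range.1 hr) hv

/-- A box of side `B` in one shifted grid meets at most `2 ^ d` boxes of another. -/
lemma card_image_boxIndex_le {B : ℕ} (hB : 0 < B) (s s' : Fin d → ℕ) (X : Finset (Fin d → ℕ))
    (hX : ∀ x ∈ X, ∀ y ∈ X, boxIndex B s' x = boxIndex B s' y) :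
    (X.image (boxIndex B s)).card ≤ 2 ^ d := by
  rcases X.eq_empty_or_nonempty with rfl | ⟨w, hw⟩
  · simp
  set q := boxIndex B s' w
  have hsub : X.image (boxIndex B s) ⊆ Fintype.piFinset fun i =>
      Finset.Icc ((q i * B - s' i + s i) / B) ((q i * B - s' i + s i) / B + 1) := by
    intro y hy
    obtain ⟨x, hx, rfl⟩ := Finset.mem_image.1 hy
    refine Fintype.mem_piFinset.2 fun i => ?_
    have h : (x i + s' i) / B = q i := congrFun (hX x hx w hw) i
    have h1 : q i * B ≤ x i + s' i := h ▸ Nat.div_mul_le_self _ _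
    have h2 : x i + s' i < q i * B + B := by
      rw [← h]; exact Nat.lt_div_mul_add hB
    exact div_mem_Icc_of_le hB (by omega) (by omega)
  refine (Finset.card_le_card hsub).trans_eq ?_
  rw [Fintype.card_piFinset]
  have : ∀ x : ℕ, x + 1 + 1 - x = 2 := fun x => by omega
  simp [this]

end UpperBound

/-! ### Heavy cells and the greedy cut. -/

section UpperBound

variable {d b m : ℕ} {A : Finset ℕ} {V : Type*}

/-- The level of a vertex together with the box of scale `j` containing it, where the boxes are
bounded by the hyperplanes whose fixed coordinate ends in `j` digits `a`. -/
def levelCell (a b j : ℕ) (lev : V → ℕ) (pos : V → Fin d → ℕ) (v : V) : ℕ × (Fin d → ℕ) :=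
  (lev v, boxIndex (b ^ j) (fun _ => repShift a b j) (pos v))

lemma levelCell_succ_eq {a : ℕ} (ha : a < b) {j : ℕ} {lev : V → ℕ} {pos : V → Fin d → ℕ} {u v : V}
    (h : levelCell a b j lev pos u = levelCell a b j lev pos v) :
    levelCell a b (j + 1) lev pos u = levelCell a b (j + 1) lev pos v := by
  simp only [levelCell, Prod.mk.injEq] at h ⊢
  refine ⟨h.1, funext fun i => ?_⟩
  simp only [boxIndex, add_repShift_succ_div ha]
  have := congrFun h.2 i
  simp only [boxIndex] at this
  rw [this]

lemma levelCell_zero_injective {a : ℕ} {lev : V → ℕ} {pos : V → Fin d → ℕ}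
    (hpos : Function.Injective pos) : Function.Injective (levelCell a b 0 lev pos) := by
  intro u v h
  simp only [levelCell, Prod.mk.injEq] at h
  refine hpos (funext fun i => ?_)
  have := congrFun h.2 i
  simp only [boxIndex, pow_zero, Nat.div_one] at this
  omega

variable [DecidableEq V] {G : SimpleGraph V} {pos : V → Fin d → ℕ} {lev : V → ℕ}
  {a N : ℕ}

/-- Each piece lies in one box of shift s and so meets at most 2^d light cells. The shift s need not
be related to a, which leaves it free to be chosen by pigeonhole. -/
lemma splitsInto_of_no_heavy_cell (hb : 0 < b)
    (hadj : ∀ u v, G.Adj u v → (orthantGraph d).Adj (pos u) (pos v) ∧ lev u = lev v)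
    {t k : ℕ} {W : Finset V} {s : Fin d → ℕ}
    (hW : ∀ v ∈ W, ∀ i, ¬ b ^ k ∣ pos v i + s i)
    (hlight : ∀ c, (W.filter fun v => levelCell a b k lev pos v = c).card ≤ t) :
    SplitsInto G W ∅ (t * 2 ^ d) := by
  classical
  refine ⟨_, fun v => (lev v, boxIndex (b ^ k) s (pos v)), ?_, ?_⟩
  · intro u hu v hv huv
    simp only [Finset.sdiff_empty] at hu hv
    obtain ⟨hor, hl⟩ := hadj u v huv
    rcases boxIndex_eq_or_of_adj (B := b ^ k) (s := s) hor with h |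
      ⟨i, hi, ⟨h1, h2⟩ | ⟨h1, h2⟩⟩
    · simp only [hl, h]
    · exact absurd h2 (hW v hv i)
    · exact absurd h2 (hW u hu i)
  · intro F hF hcF
    rw [Finset.sdiff_empty] at hF
    rcases F.eq_empty_or_nonempty with rfl | ⟨z, hz⟩
    · simp
    have h1 : F.card ≤ t * (F.image (levelCell a b k lev pos)).card :=
      Finset.card_le_mul_card_image F t fun c _ =>
        (Finset.card_le_card (Finset.filter_subset_filter _ hF)).trans (hlight c)
    refine h1.trans (Nat.mul_le_mul_left _ ?_)
    have h2 := card_image_boxIndex_le (B := b ^ k) (by positivity) (fun _ => repShift a b k) s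
      (F.image pos) (by
        intro x hx y hy
        obtain ⟨u, hu, rfl⟩ := Finset.mem_image.1 hx
        obtain ⟨v, hv, rfl⟩ := Finset.mem_image.1 hy
        exact congrArg Prod.snd (hcF u hu v hv))
    refine le_trans ?_ h2
    refine (Finset.card_le_card (t := {lev z} ×ˢ ((F.image pos).image
      (boxIndex (b ^ k) fun _ => repShift a b k))) ?_).trans (by simp)
    intro c hc
    obtain ⟨v, hv, rfl⟩ := Finset.mem_image.1 hc
    rw [Finset.mem_product]
    refine ⟨?_, Finset.mem_image_of_mem _ (Finset.mem_image_of_mem _ hv)⟩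
    rw [Finset.mem_singleton]
    exact congrArg Prod.fst (hcF v hv z hz)

variable [Fintype V]

/-- A minimal heavy cell can be isolated and split along the separators of its children. -/
lemma exists_isolating_separator (hd : 0 < d) (hb : 0 < b) (ha : a < b) (hN0 : 0 < N)
    (hN : ∀ i₀ : Fin d, (digitSlice d b A m a i₀).card ≤ N) (hpos : Function.Injective pos)
    (hmem : ∀ v, pos v ∈ spongeVerts d b A m (lev v))
    (hadj : ∀ u v, G.Adj u v → (orthantGraph d).Adj (pos u) (pos v) ∧ lev u = lev v)
    {t j k : ℕ} (hjk : j ≤ k) {W : Finset V} {c : ℕ × (Fin d → ℕ)}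
    (hc : t < (W.filter fun v => levelCell a b j lev pos v = c).card)
    (hmin : ∀ j' < j, ∀ c', (W.filter fun v => levelCell a b j' lev pos v = c').card ≤ t) :
    ∃ S Q : Finset V, S.card ≤ d * (b + 1) ^ d * N ^ k ∧ Q ⊆ W ∧ t < Q.card ∧
      (∀ u ∈ Q \ S, ∀ v ∈ W \ S, G.Adj u v → v ∈ Q) ∧ SplitsInto G Q S t := by
  classical
  set Q := W.filter fun v => levelCell a b j lev pos v = c
  obtain ⟨w, hw⟩ : Q.Nonempty := Finset.card_pos.1 (by omega)
  have hQW : Q ⊆ W := Finset.filter_subset _ _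
  rcases j with _ | j
  -- A cell of side 1 is a single vertex, which is deleted.
  · refine ⟨Q, Q, ?_, hQW, hc, by simp, Unit, fun _ => (), by simp, fun F hF _ => ?_⟩
    · have : Q.card ≤ 1 := by
        rw [Finset.card_le_one]
        intro u hu v hv
        simp only [Q, Finset.mem_filter] at hu hv
        exact levelCell_zero_injective hpos (hu.2.trans hv.2.symm)
      refine this.trans (Nat.one_le_iff_ne_zero.2 ?_)
      positivity
    · have : F = ∅ := by simpa using hF
      simp [this]
  -- Truncated subtraction clips the box to the orthant.
  set lo : Fin d → ℕ := fun i => c.2 i * b ^ (j + 1) - repShift a b (j + 1)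
  have hB : 0 < b ^ (j + 1) := by positivity
  have hbox : ∀ v ∈ Q, lev v = c.1 ∧ ∀ i, lo i ≤ pos v i ∧ pos v i < lo i + b * b ^ j := by
    intro v hv
    have hv := (Finset.mem_filter.1 hv).2
    refine ⟨congrArg Prod.fst hv, fun i => ?_⟩
    have h : (pos v i + repShift a b (j + 1)) / b ^ (j + 1) = c.2 i :=
      congrFun (congrArg Prod.snd hv) i
    have h1 : c.2 i * b ^ (j + 1) ≤ pos v i + repShift a b (j + 1) :=
      h ▸ Nat.div_mul_le_self _ _
    have h2 : pos v i + repShift a b (j + 1) < c.2 i * b ^ (j + 1) + b ^ (j + 1) := by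
      rw [← h]; exact Nat.lt_div_mul_add hB
    rw [← pow_succ']
    simp only [lo]
    omega
  -- Hyperplanes of scale j + 1 are also of scale j, so S holds the outer walls of the cell as well
  -- as those between its children. The upper face belongs to the next cell, hence the non-strict
  -- bound.
  set S := Finset.univ.filter fun v => lev v = c.1 ∧
    (∀ i, lo i ≤ pos v i ∧ pos v i ≤ lo i + b * b ^ j) ∧
      ∃ i, b ^ j ∣ pos v i + repShift a b j
  have hsame : ∀ u ∈ Q \ S, ∀ v ∉ S, G.Adj u v →
      levelCell a b j lev pos u = levelCell a b j lev pos v := by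
    intro u hu v hv huv
    obtain ⟨huQ, huS⟩ := Finset.mem_sdiff.1 hu
    obtain ⟨hlu, hbu⟩ := hbox u huQ
    obtain ⟨hor, hl⟩ := hadj u v huv
    rcases boxIndex_eq_or_of_adj (B := b ^ j) (s := fun _ => repShift a b j) hor with h |
      ⟨i, hi, ⟨h1, h2⟩ | ⟨h1, h2⟩⟩
    · simp only [levelCell, hl, h]
    · refine absurd ?_ hv
      simp only [S, Finset.mem_filter, Finset.mem_univ, true_and]
      refine ⟨hl ▸ hlu, fun l => ?_, i, h2⟩
      have := hbu l
      by_cases hli : l = i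
      · subst hli; omega
      · rw [← hi l hli]; omega
    · refine absurd ?_ huS
      simp only [S, Finset.mem_filter, Finset.mem_univ, true_and]
      exact ⟨hlu, fun l => ⟨(hbu l).1, (hbu l).2.le⟩, i, h2⟩
  refine ⟨S, Q, ?_, hQW, hc, ?_, _, levelCell a b j lev pos, ?_, ?_⟩
  · have h1 : S.card ≤ d * (b + 1) ^ d * N ^ j := by
      refine card_separator_le hb ha hN0 hN hpos j c.1 lo S fun v hv => ?_
      simp only [S, Finset.mem_filter, Finset.mem_univ, true_and] at hv
      exact ⟨hv.1 ▸ hmem v, hv.2⟩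
    refine h1.trans (Nat.mul_le_mul_left _ (Nat.pow_le_pow_right hN0 (by omega)))
  · intro u hu v hv huv
    have h := levelCell_succ_eq ha (hsame u hu v (Finset.mem_sdiff.1 hv).2 huv)
    simp only [Q, Finset.mem_filter, Finset.mem_sdiff] at hu ⊢
    exact ⟨(Finset.mem_sdiff.1 hv).1, h ▸ hu.1.2⟩
  · intro u hu v hv huv
    exact hsame u hu v (Finset.mem_sdiff.1 hv).2 huv
  · intro F hF hcF
    rcases F.eq_empty_or_nonempty with rfl | ⟨z, hz⟩
    · simp
    refine le_trans (Finset.card_le_card fun v hv => ?_)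
      (hmin j (by omega) (levelCell a b j lev pos z))
    rw [Finset.mem_filter]
    exact ⟨hQW (Finset.mem_sdiff.1 (hF hv)).1, hcF v hv z hz⟩

theorem cutSize_le_of_card_le (hd : 0 < d) (hb : 0 < b) (ha : a < b) (hN0 : 0 < N)
    (hN : ∀ i₀ : Fin d, (digitSlice d b A m a i₀).card ≤ N) (hpos : Function.Injective pos)
    (hmem : ∀ v, pos v ∈ spongeVerts d b A m (lev v))
    (hadj : ∀ u v, G.Adj u v → (orthantGraph d).Adj (pos u) (pos v) ∧ lev u = lev v)
    {ε : ℝ} (hε : 0 < ε) {k : ℕ} (hk : Fintype.card V ≤ (b * N) ^ k) :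
    cutSize ε G ≤ (⌈2 ^ d / ε⌉₊ * (d * (b + 1) ^ d) + d) * N ^ k := by
  classical
  have hB : 0 < b ^ k := by positivity
  choose s hs hsc using fun i : Fin d =>
    exists_shift_card_le hB (hk.trans_eq (mul_pow b N k)) (fun v => pos v i)
  set S₀ : Finset V := Finset.univ.biUnion fun i : Fin d =>
    Finset.univ.filter fun v => b ^ k ∣ pos v i + s i
  have hS₀ : S₀.card ≤ d * N ^ k := by
    refine (Finset.card_biUnion_le_card_mul _ _ (N ^ k) fun i _ => hsc i).trans (by simp)
  set n := Fintype.card V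
  -- With this t, 2^d light cells hold at most εn vertices; with r below, r steps using more than t
  -- vertices each exhaust all n.
  set t := ⌊ε * n / 2 ^ d⌋₊
  set r := ⌈2 ^ d / ε⌉₊
  have hr : n ≤ r * (t + 1) := by
    have h1 : ε * n / 2 ^ d ≤ (t : ℝ) + 1 := (Nat.lt_floor_add_one _).le
    have h2 : 2 ^ d / ε ≤ (r : ℝ) := Nat.le_ceil _
    have h3 : (n : ℝ) ≤ r * (t + 1) := by
      calc (n : ℝ) = (2 ^ d / ε) * (ε * n / 2 ^ d) := by field_simp
        _ ≤ r * (t + 1) := by gcongr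
    exact_mod_cast h3
  obtain ⟨S, hS, ι, f, hf, hfL⟩ := exists_splitsInto_of_greedy (G := G) (L := t * 2 ^ d)
    (K := d * (b + 1) ^ d * N ^ k) (t := t) (W₀ := Finset.univ \ S₀) (fun W hW => by
      by_cases hheavy : ∃ j, j ≤ k ∧ ∃ c, t < (W.filter fun v => levelCell a b j lev pos v = c).card
      · right
        obtain ⟨hjk, c, hc⟩ := Nat.find_spec hheavy
        obtain ⟨S, Q, h1, h2, h3, h4, ι, f, hf, hfL⟩ :=
          exists_isolating_separator hd hb ha hN0 hN hpos hmem hadj hjk hc (fun j' hj' c' => by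
            by_contra! hn
            exact Nat.find_min hheavy hj' ⟨by omega, c', hn⟩)
        exact ⟨S, Q, h1, h2, h3, h4, ι, f, hf, fun F h h' => (hfL F h h').trans
          (Nat.le_mul_of_pos_right _ (by positivity))⟩
      · left
        push Not at hheavy
        refine splitsInto_of_no_heavy_cell (a := a) (s := s) hb hadj (fun v hv i hdvd => ?_)
          (hheavy k le_rfl)
        have := (Finset.mem_sdiff.1 (hW hv)).2
        exact this (by simp only [S₀, Finset.mem_biUnion]; exact ⟨i, by simp, by simpa using hdvd⟩))
    r (Finset.univ \ S₀) subset_rfl ((Finset.card_le_univ _).trans hr)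
  have he : (Finset.univ : Finset V) \ (S ∪ S₀) = (Finset.univ \ S₀) \ S := by
    ext v; simp [and_comm]
  have hsplit : SplitsInto G Finset.univ (S ∪ S₀) (t * 2 ^ d) :=
    ⟨ι, f, by rw [he]; exact hf, by rw [he]; exact hfL⟩
  refine (cutSize_le_of_splitsInto hsplit ?_).trans ((Finset.card_union_le _ _).trans ?_)
  · have : (t : ℝ) ≤ ε * n / 2 ^ d := Nat.floor_le (by positivity)
    rw [le_div_iff₀ (by positivity)] at this
    rw [Nat.card_eq_fintype_card]
    push_cast
    exact this
  · calc S.card + S₀.card ≤ r * (d * (b + 1) ^ d * N ^ k) + d * N ^ k := add_le_add hS hS₀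
      _ = _ := by ring

end UpperBound

/-! ### From finite subgraphs to the separation profile. -/

section Profile

variable {d b m : ℕ} {A : Finset ℕ}

lemma cutSize_le_card {V : Type*} [Finite V] {ε : ℝ} (hε : 0 ≤ ε) (G : SimpleGraph V) :
    cutSize ε G ≤ Nat.card V := by
  rw [← Set.ncard_univ]
  exact cutSize_le_of_label (L := 0) Set.univ (fun _ => ()) (by simp) (by simp) (by simp; positivity)

lemma mem_sponge_verts {x : Fin d → ℕ} :
    x ∈ (sponge d b A m).verts ↔ ∃ k, x ∈ spongeVerts d b A m k := by
  simp [sponge, spongeLevel]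

lemma sponge_adj {x y : Fin d → ℕ} :
    (sponge d b A m).Adj x y ↔ ∃ k, x ∈ spongeVerts d b A m k ∧ y ∈ spongeVerts d b A m k ∧
      (orthantGraph d).Adj x y := by
  simp [sponge, spongeLevel]

lemma div_pow_mod_eq_zero {x k l : ℕ} (hb : 0 < b) (hx : x < b ^ k) (hl : k ≤ l) :
    x / b ^ l % b = 0 := by
  rw [Nat.div_eq_of_lt (hx.trans_le (Nat.pow_le_pow_right hb hl)), Nat.zero_mod]

/-- An extra leading zero is harmless if 0 ∉ A or if the digit condition is vacuous. -/
lemma spongeVerts_mono (hb : 0 < b) (h : 0 ∉ A ∨ d ≤ m) : Monotone (spongeVerts d b A m) := by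
  refine monotone_nat_of_le_succ fun k x hx => ⟨fun i => (hx.1 i).trans_le
    (Nat.pow_le_pow_right hb (Nat.le_succ k)), fun j hj => ?_⟩
  rcases h with h | h
  · rcases Nat.lt_succ_iff_lt_or_eq.1 hj with hj | rfl
    · exact hx.2 j hj
    · simp [div_pow_mod_eq_zero hb (hx.1 _) le_rfl, h]
  · exact (Finset.card_le_univ _).trans (by simpa using h)

/-- At position k all d digits of a point of V_k are 0 ∈ A, too many for any higher level. -/
lemma spongeVerts_level_unique (hb : 0 < b) (h0 : 0 ∈ A) (hm : m < d) {x : Fin d → ℕ} {k l : ℕ}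
    (hk : x ∈ spongeVerts d b A m k) (hl : x ∈ spongeVerts d b A m l) : k = l := by
  have key : ∀ k l, x ∈ spongeVerts d b A m k → x ∈ spongeVerts d b A m l → ¬ k < l := by
    intro k l hk hl hkl
    have := hl.2 k hkl
    simp [div_pow_mod_eq_zero hb (hk.1 _) le_rfl, h0] at this
    omega
  have h1 := key k l hk hl
  have h2 := key l k hl hk
  omega

/-- The vertices of a finite subgraph can be given levels that are constant along edges. -/
lemma exists_level {V : Type*} [Finite V] (hb : 0 < b) {G : SimpleGraph V} {pos : V → Fin d → ℕ}
    (hmem : ∀ v, pos v ∈ (sponge d b A m).verts)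
    (hadj : ∀ u v, G.Adj u v → (sponge d b A m).Adj (pos u) (pos v)) :
    ∃ lev : V → ℕ, (∀ v, pos v ∈ spongeVerts d b A m (lev v)) ∧
      ∀ u v, G.Adj u v → (orthantGraph d).Adj (pos u) (pos v) ∧ lev u = lev v := by
  choose lev hlev using fun v => mem_sponge_verts.1 (hmem v)
  by_cases h : 0 ∉ A ∨ d ≤ m
  · obtain ⟨K, hK⟩ := (Set.finite_range lev).bddAbove
    refine ⟨fun _ => K, fun v => spongeVerts_mono hb h (hK ⟨v, rfl⟩) (hlev v), fun u v huv => ?_⟩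
    obtain ⟨_, _, _, h⟩ := sponge_adj.1 (hadj u v huv)
    exact ⟨h, rfl⟩
  · push Not at h
    refine ⟨lev, hlev, fun u v huv => ?_⟩
    obtain ⟨k, h1, h2, h3⟩ := sponge_adj.1 (hadj u v huv)
    exact ⟨h3, (spongeVerts_level_unique hb h.1 h.2 (hlev u) h1).trans
      (spongeVerts_level_unique hb h.1 h.2 h2 (hlev v))⟩

/-- The identity behind E: (bN)^k vertices against separators of order N^k. -/
lemma rpow_spongeE (hb : 1 < b) (hN : 0 < spongeN d b A m) :
    ((b * spongeN d b A m : ℕ) : ℝ) ^ spongeE d b A m = spongeN d b A m := by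
  have hN' : (0 : ℝ) < spongeN d b A m := by exact_mod_cast hN
  have hb' : (1 : ℝ) < b := by exact_mod_cast hb
  have h1 : 0 ≤ Real.log (spongeN d b A m) := Real.log_natCast_nonneg _
  have h2 : 0 < Real.log b := Real.log_pos hb'
  rw [Nat.cast_mul, Real.rpow_def_of_pos (by positivity), Real.log_mul (by positivity) hN'.ne',
    spongeE, add_comm (Real.log b), mul_div_cancel₀ _ (by positivity), Real.exp_log hN']

lemma spongeE_nonneg : 0 ≤ spongeE d b A m := by
  have h1 : 0 ≤ Real.log (spongeN d b A m) := Real.log_natCast_nonneg _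
  have h2 : 0 ≤ Real.log b := Real.log_natCast_nonneg _
  unfold spongeE
  positivity

lemma pow_rpow_spongeE (hb : 1 < b) (hN : 0 < spongeN d b A m) (k : ℕ) :
    (((b * spongeN d b A m) ^ k : ℕ) : ℝ) ^ spongeE d b A m = (spongeN d b A m : ℝ) ^ k := by
  rw [Nat.cast_pow, ← Real.rpow_pow_comm (Nat.cast_nonneg _), rpow_spongeE hb hN]

theorem exists_cutSize_le (hd : 0 < d) (hb : 1 < b) (hA : A ⊆ Finset.range b)
    (hN : 0 < spongeN d b A m) {ε : ℝ} (hε : 0 < ε) :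
    ∃ C : ℝ, 0 ≤ C ∧ ∀ G : (sponge d b A m).coe.Subgraph, G.verts.Finite →
      (cutSize ε G.coe : ℝ) ≤ C * (G.verts.ncard : ℝ) ^ spongeE d b A m := by
  classical
  obtain ⟨a, ha, hslice⟩ := exists_digit_card_digitSlice_le (d := d) (by omega) hA hN
  set N := spongeN d b A m
  set C₀ := ⌈2 ^ d / ε⌉₊ * (d * (b + 1) ^ d) + d
  refine ⟨C₀ * N, by positivity, fun G hG => ?_⟩
  have : Fintype G.verts := hG.fintype
  have hcard : G.verts.ncard = Fintype.card G.verts := by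
    rw [← Nat.card_coe_set_eq, Nat.card_eq_fintype_card]
  obtain ⟨lev, hlev, hadj⟩ := exists_level (A := A) (m := m) (by omega) (G := G.coe)
    (pos := fun v => v.1.1) (fun v => v.1.2) (fun u v huv => by simpa using G.coe_adj_sub u v huv)
  have hbN : 1 < b * N := lt_of_lt_of_le hb (Nat.le_mul_of_pos_right _ hN)
  have hcut : ∀ k, Fintype.card G.verts ≤ (b * N) ^ k → cutSize ε G.coe ≤ C₀ * N ^ k := fun k hk =>
    cutSize_le_of_card_le hd (by omega) ha hN hslice
      (Subtype.val_injective.comp Subtype.val_injective) hlev hadj hε hk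
  rcases Nat.eq_zero_or_pos (Fintype.card G.verts) with h0 | h0
  · have : cutSize ε G.coe = 0 := by
      have := cutSize_le_card hε.le G.coe
      rw [Nat.card_eq_fintype_card, h0] at this
      omega
    rw [this, Nat.cast_zero]
    positivity
  -- Rounding up to a power of bN costs only a factor N.
  · set k := Nat.log (b * N) (Fintype.card G.verts)
    have h1 := hcut (k + 1) (Nat.lt_pow_succ_log_self hbN _).le
    have h2 : (b * N) ^ k ≤ Fintype.card G.verts := Nat.pow_log_le_self _ h0.ne'
    calc (cutSize ε G.coe : ℝ) ≤ C₀ * N ^ (k + 1) := by exact_mod_cast h1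
      _ = C₀ * N * (N : ℝ) ^ k := by ring
      _ = C₀ * N * (((b * N) ^ k : ℕ) : ℝ) ^ spongeE d b A m := by rw [pow_rpow_spongeE hb hN]
      _ ≤ C₀ * N * (G.verts.ncard : ℝ) ^ spongeE d b A m := by
        rw [hcard]
        have := spongeE_nonneg (d := d) (b := b) (A := A) (m := m)
        gcongr

theorem sepProfile_isBigO (hd : 0 < d) (hb : 1 < b) (hA : A ⊆ Finset.range b)
    (hN : 0 < spongeN d b A m) {ε : ℝ} (hε : 0 < ε) :
    (fun n : ℕ => (sepProfile ε (sponge d b A m).coe n : ℝ)) =O[atTop]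
      fun n : ℕ => (n : ℝ) ^ spongeE d b A m := by
  obtain ⟨C, hC, h⟩ := exists_cutSize_le hd hb hA hN hε
  refine IsBigO.of_bound C (Eventually.of_forall fun n => ?_)
  rw [Real.norm_of_nonneg (Nat.cast_nonneg _), Real.norm_of_nonneg (by positivity)]
  have : sepProfile ε (sponge d b A m).coe n ≤ ⌊C * (n : ℝ) ^ spongeE d b A m⌋₊ := by
    refine csSup_le' ?_
    rintro c ⟨G, hG, hn, rfl⟩
    refine Nat.le_floor ((h G hG).trans ?_)
    have := spongeE_nonneg (d := d) (b := b) (A := A) (m := m)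
    gcongr
  exact (Nat.cast_le.2 this).trans (Nat.floor_le (by positivity))

/-- The bound by n matters: `sSup` of an unbounded set of naturals is 0. -/
lemma le_sepProfile {V : Type*} {ε : ℝ} (hε : 0 ≤ ε) {X : SimpleGraph V} {n : ℕ} {G : X.Subgraph}
    (hG : G.verts.Finite) (hn : G.verts.ncard ≤ n) : cutSize ε G.coe ≤ sepProfile ε X n := by
  refine le_csSup ⟨n, ?_⟩ ⟨G, hG, hn, rfl⟩
  rintro c ⟨H, hH, hHn, rfl⟩
  have : Finite H.verts := hH
  exact (cutSize_le_card hε _).trans ((Nat.card_coe_set_eq _).trans_le hHn)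

end Profile

/-! ### Lines and axis-parallel paths in a line grid. -/

section LineGrid

variable {d B : ℕ} {C : Finset ℕ}

/-- The points of `[0, B)^d` all of whose coordinates but one lie in `C`. -/
def lineGrid (d B : ℕ) (C : Finset ℕ) : Finset (Fin d → ℕ) :=
  Finset.univ.biUnion fun i : Fin d =>
    Fintype.piFinset fun j => if j = i then Finset.range B else C

lemma mem_lineGrid_of {x : Fin d → ℕ} {i : Fin d} (hi : x i < B)
    (h : ∀ j ≠ i, x j ∈ C) : x ∈ lineGrid d B C := by
  refine Finset.mem_biUnion.2 ⟨i, Finset.mem_univ _, Fintype.mem_piFinset.2 fun j => ?_⟩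
  by_cases hj : j = i
  · subst hj; simpa using hi
  · simpa [hj] using h j hj

lemma exists_of_mem_lineGrid {x : Fin d → ℕ} (h : x ∈ lineGrid d B C) :
    ∃ i, x i < B ∧ ∀ j ≠ i, x j ∈ C := by
  obtain ⟨i, -, hi⟩ := Finset.mem_biUnion.1 h
  rw [Fintype.mem_piFinset] at hi
  refine ⟨i, by simpa using hi i, fun j hj => by simpa [hj] using hi j⟩

lemma card_line_family (i : Fin d) :
    (Fintype.piFinset fun j : Fin d => if j = i then Finset.range B else C).card =
      B * C.card ^ (d - 1) := by
  rw [Fintype.card_piFinset]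
  simp only [apply_ite Finset.card, Finset.card_range]
  rw [← Finset.mul_prod_erase _ _ (Finset.mem_univ i)]
  rw [Finset.prod_congr rfl (g := fun _ => C.card) fun j hj => by
    simp [(Finset.mem_erase.1 hj).1]]
  simp

lemma card_lineGrid_le : (lineGrid d B C).card ≤ d * (B * C.card ^ (d - 1)) := by
  refine (Finset.card_biUnion_le_card_mul _ _ _ fun i _ => (card_line_family i).le).trans (by simp)

lemma le_card_lineGrid (hd : 0 < d) : B * C.card ^ (d - 1) ≤ (lineGrid d B C).card := by
  rw [← card_line_family (⟨0, hd⟩ : Fin d)]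
  exact Finset.card_le_card (Finset.subset_biUnion_of_mem
    (fun i : Fin d => Fintype.piFinset fun j => if j = i then Finset.range B else C)
    (Finset.mem_univ _))

/-- The line in direction `i` through `p` avoids `T`. -/
def LineAvoids (T : Finset (Fin d → ℕ)) (i : Fin d) (p : Fin d → ℕ) : Prop :=
  ∀ s ∈ T, ∃ j ≠ i, s j ≠ p j

/-- The point whose coordinates before `n` are those of `y` and from `n` on those of `x`. -/
def splice (x y : Fin d → ℕ) (n : ℕ) : Fin d → ℕ := fun j => if (j : ℕ) < n then y j else x j

/-- The axis-parallel path from `x` to `y` that changes the coordinates in order avoids `T`. -/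
def PathAvoids (T : Finset (Fin d → ℕ)) (x y : Fin d → ℕ) : Prop :=
  ∀ i : Fin d, LineAvoids T i (splice x y i)

open Classical in
/-- Some point of `C ^ d` has few points that cannot be reached along an axis-parallel path. -/
lemma exists_card_not_pathAvoids_le (hC : C.Nonempty) (T : Finset (Fin d → ℕ)) :
    ∃ x ∈ Fintype.piFinset fun _ : Fin d => C,
      ((Fintype.piFinset fun _ : Fin d => C).filter fun y => ¬ PathAvoids T x y).card ≤
        d * T.card * C.card := by
  set P := Fintype.piFinset fun _ : Fin d => C
  have hPc : P.card = C.card ^ d := by simp [P]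
  have hP : P.Nonempty := Finset.card_pos.1 (by rw [hPc]; exact pow_pos hC.card_pos d)
  refine Finset.exists_le_of_sum_le (f := fun x => (P.filter fun y => ¬ PathAvoids T x y).card)
    (g := fun _ => d * T.card * C.card) hP ?_
  have h1 : ∑ x ∈ P, (P.filter fun y => ¬ PathAvoids T x y).card =
      ((P ×ˢ P).filter fun z => ¬ PathAvoids T z.1 z.2).card := by
    simp only [Finset.card_filter, Finset.sum_product]
  rw [h1]
  -- If s blocks segment i, it fixes x_j for j > i and y_j for j < i. This leaves (i + 1) + (d - i)
  -- = d + 1 free coordinates, hence |C|^(d+1) pairs for each i and s.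
  have hsub : ((P ×ˢ P).filter fun z => ¬ PathAvoids T z.1 z.2) ⊆
      ((Finset.univ : Finset (Fin d)) ×ˢ T).biUnion fun it =>
        (Fintype.piFinset fun j => if it.1 < j then {it.2 j} else C) ×ˢ
        (Fintype.piFinset fun j => if j < it.1 then {it.2 j} else C) := by
    intro z hz
    obtain ⟨hxy, hz⟩ := Finset.mem_filter.1 hz
    obtain ⟨hx, hy⟩ := Finset.mem_product.1 hxy
    simp only [PathAvoids, LineAvoids] at hz
    push Not at hz
    obtain ⟨i, s, hs, h⟩ := hz
    simp only [Finset.mem_biUnion, Finset.mem_product, Finset.mem_univ, true_and,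
      Fintype.mem_piFinset]
    refine ⟨(i, s), hs, fun j => ?_, fun j => ?_⟩
    · by_cases hj : i < j
      · have := h j hj.ne'
        simp only [splice, Fin.val_fin_lt, not_lt.2 hj.le, if_false] at this
        simp [hj, this]
      · simpa [hj] using Fintype.mem_piFinset.1 hx j
    · by_cases hj : j < i
      · have := h j hj.ne
        simp only [splice, Fin.val_fin_lt, hj, if_true] at this
        simp [hj, this]
      · simpa [hj] using Fintype.mem_piFinset.1 hy j
  refine (Finset.card_le_card hsub).trans ((Finset.card_biUnion_le_card_mul _ _
    (C.card ^ (d + 1)) fun it _ => le_of_eq ?_).trans_eq ?_)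
  · rw [Finset.card_product, Fintype.card_piFinset, Fintype.card_piFinset, ← Finset.prod_mul_distrib,
      ← Finset.mul_prod_erase _ _ (Finset.mem_univ it.1),
      Finset.prod_congr rfl (g := fun _ => C.card)]
    · have hd : 0 < d := it.1.pos
      simp only [lt_irrefl, if_false, Finset.prod_const, Finset.card_erase_of_mem (Finset.mem_univ _),
        Finset.card_univ, Fintype.card_fin]
      obtain ⟨e, rfl⟩ := Nat.exists_eq_succ_of_ne_zero hd.ne'
      simp only [Nat.succ_sub_one, Nat.succ_eq_add_one]
      ring
    · intro j hj
      rcases lt_or_gt_of_ne (Finset.mem_erase.1 hj).1 with h | h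
      · simp [h, not_lt.2 h.le]
      · simp [h, not_lt.2 h.le]
  · rw [Finset.card_product, Finset.sum_const, hPc]
    simp only [Finset.card_univ, Fintype.card_fin, smul_eq_mul]
    ring

open Classical in
/-- Few points of the line grid lie on no line that avoids `T` and meets the set `R` of points
reached from `x` by avoiding paths. -/
lemma card_lineGrid_sdiff_le (hC : C.Nonempty)
    (T : Finset (Fin d → ℕ)) {x : Fin d → ℕ}
    (hx : ((Fintype.piFinset fun _ : Fin d => C).filter fun y => ¬ PathAvoids T x y).card ≤
        d * T.card * C.card) {R : Finset (Fin d → ℕ)}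
    (hR : ∀ v i t, v i < B → (∀ j ≠ i, v j ∈ C) → LineAvoids T i v → t ∈ C →
      PathAvoids T x (Function.update v i t) → v ∈ R) :
    (lineGrid d B C \ R).card ≤ (d + d ^ 2) * T.card * B := by
  set Y := (Fintype.piFinset fun _ : Fin d => C).filter fun y => ¬ PathAvoids T x y
  set F := fun i : Fin d => Fintype.piFinset fun j => if j = i then Finset.range B else C
  have hF : ∀ i v, v ∈ F i → v i < B ∧ ∀ j ≠ i, v j ∈ C := by
    intro i v hv
    rw [Fintype.mem_piFinset] at hv
    exact ⟨by simpa using hv i, fun j hj => by simpa [hj] using hv j⟩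
  have h1 : ∀ i, ((F i).filter fun v => ¬ LineAvoids T i v).card ≤ T.card * B := by
    intro i
    refine (Finset.card_le_card (t := (T ×ˢ Finset.range B).image
      fun sr => Function.update sr.1 i sr.2) fun v hv => ?_).trans
      (Finset.card_image_le.trans (by simp))
    rw [Finset.mem_filter] at hv
    obtain ⟨hv, hbad⟩ := hv
    unfold LineAvoids at hbad
    push Not at hbad
    obtain ⟨s, hs, h⟩ := hbad
    refine Finset.mem_image.2 ⟨(s, v i), by simp [hs, (hF i v hv).1], funext fun j => ?_⟩
    by_cases hj : j = i
    · subst hj; simp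
    · simp [hj, h j hj]
  -- On an open line with a point outside R, all |C| points of C^d are unreached. Counting pairs (v,
  -- t) trades this factor |C| for the one in `hx`.
  have h2 : ∀ i, ((F i \ R).filter fun v => LineAvoids T i v).card ≤ d * T.card * B := by
    intro i
    have hinj : Set.InjOn (fun vt : (Fin d → ℕ) × ℕ => (Function.update vt.1 i vt.2, vt.1 i))
        (((F i \ R).filter fun v => LineAvoids T i v) ×ˢ C : Finset _) := by
      rintro ⟨v, t⟩ _ ⟨w, r⟩ _ h
      simp only [Prod.mk.injEq] at h
      obtain ⟨h, hi⟩ := h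
      have ht : t = r := by simpa using congrFun h i
      refine Prod.ext (funext fun j => ?_) ht
      by_cases hj : j = i
      · subst hj; exact hi
      · simpa [hj] using congrFun h j
    have hmaps : Set.MapsTo (fun vt : (Fin d → ℕ) × ℕ => (Function.update vt.1 i vt.2, vt.1 i))
        (((F i \ R).filter fun v => LineAvoids T i v) ×ˢ C : Finset _)
        (Y ×ˢ Finset.range B : Finset _) := by
      rintro ⟨v, t⟩ h
      simp only [Finset.coe_product, Set.mem_prod, Finset.mem_coe, Finset.mem_filter,
        Finset.mem_sdiff] at h
      obtain ⟨⟨⟨hv, hvR⟩, hl⟩, ht⟩ := h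
      obtain ⟨hvi, hvj⟩ := hF i v hv
      simp only [Finset.coe_product, Set.mem_prod, Finset.mem_coe, Finset.mem_range]
      refine ⟨Finset.mem_filter.2 ⟨Fintype.mem_piFinset.2 fun j => ?_, fun hp =>
        hvR (hR v i t hvi hvj hl ht hp)⟩, hvi⟩
      by_cases hj : j = i
      · subst hj; simpa using ht
      · simpa [hj] using hvj j hj
    have h := Finset.card_le_card_of_injOn _ hmaps hinj
    rw [Finset.card_product, Finset.card_product, Finset.card_range] at h
    refine Nat.le_of_mul_le_mul_right (h.trans ?_) hC.card_pos
    calc Y.card * B ≤ d * T.card * C.card * B := Nat.mul_le_mul_right _ hx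
      _ = _ := by ring
  have hsub : lineGrid d B C \ R ⊆ Finset.univ.biUnion fun i =>
      ((F i).filter fun v => ¬ LineAvoids T i v) ∪
        ((F i \ R).filter fun v => LineAvoids T i v) := by
    intro v hv
    obtain ⟨hv, hvR⟩ := Finset.mem_sdiff.1 hv
    obtain ⟨i, -, hi⟩ := Finset.mem_biUnion.1 hv
    refine Finset.mem_biUnion.2 ⟨i, Finset.mem_univ _, ?_⟩
    have hi : v ∈ F i := hi
    by_cases hl : LineAvoids T i v <;> simp [hl, hi, hvR]
  refine (Finset.card_le_card hsub).trans ((Finset.card_biUnion_le_card_mul _ _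
    (T.card * B + d * T.card * B) fun i _ => (Finset.card_union_le _ _).trans
      (add_le_add (h1 i) (h2 i))).trans_eq ?_)
  simp only [Finset.card_univ, Fintype.card_fin]
  ring

end LineGrid

/-! ### Large components of a line grid after deletions. -/

section LowerBound

variable {d B : ℕ} {C : Finset ℕ} {V : Type*} {G : SimpleGraph V} {pos : V → Fin d → ℕ}

/-- The points `p` and `q` are positions of vertices joined by a path avoiding `S`. -/
def JoinedOff (G : SimpleGraph V) (pos : V → Fin d → ℕ) (S : Set V) (p q : Fin d → ℕ) : Prop :=
  ∃ u v : (Sᶜ : Set V), pos u = p ∧ pos v = q ∧ (G.induce Sᶜ).Reachable u v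

lemma JoinedOff.symm {S : Set V} {p q : Fin d → ℕ} (h : JoinedOff G pos S p q) :
    JoinedOff G pos S q p := by
  obtain ⟨u, v, hu, hv, h⟩ := h
  exact ⟨v, u, hv, hu, h.symm⟩

lemma JoinedOff.trans (hpos : Function.Injective pos) {S : Set V} {p q r : Fin d → ℕ}
    (h : JoinedOff G pos S p q) (h' : JoinedOff G pos S q r) : JoinedOff G pos S p r := by
  obtain ⟨u, v, hu, hv, h⟩ := h
  obtain ⟨v', w, hv', hw, h'⟩ := h'
  obtain rfl : v = v' := Subtype.ext (hpos (hv.trans hv'.symm))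
  exact ⟨u, w, hu, hw, h.trans h'⟩

lemma joinedOff_line (hpos : Function.Injective pos)
    (hsurj : ∀ p ∈ lineGrid d B C, ∃ v, pos v = p)
    (hadj : ∀ u v, (orthantGraph d).Adj (pos u) (pos v) → G.Adj u v)
    {S : Set V} {T : Finset (Fin d → ℕ)} (hT : ∀ v ∈ S, pos v ∈ T) {i : Fin d} {p : Fin d → ℕ}
    (hp : ∀ j ≠ i, p j ∈ C) (havoid : LineAvoids T i p) {r t : ℕ} (hr : r < B) (ht : t < B) :
    JoinedOff G pos S (Function.update p i r) (Function.update p i t) := by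
  have hv : ∀ r < B, ∃ v : (Sᶜ : Set V), pos v = Function.update p i r := by
    intro r hr
    obtain ⟨v, hv⟩ := hsurj (Function.update p i r)
      (mem_lineGrid_of (i := i) (by simpa using hr) fun j hj => by simpa [hj] using hp j hj)
    refine ⟨⟨v, fun hvS => ?_⟩, hv⟩
    obtain ⟨j, hj, hne⟩ := havoid _ (hT v hvS)
    exact hne (by rw [hv]; simp [hj])
  have h0 : ∀ r < B, JoinedOff G pos S (Function.update p i 0) (Function.update p i r) := by
    intro r
    induction r with
    | zero =>
      intro hr
      obtain ⟨v, hv⟩ := hv 0 hr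
      exact ⟨v, v, hv, hv, SimpleGraph.Reachable.refl _⟩
    | succ r ih =>
      intro hr
      obtain ⟨u, hu⟩ := hv r (by omega)
      obtain ⟨v, hv⟩ := hv (r + 1) hr
      refine (ih (by omega)).trans hpos ⟨u, v, hu, hv, SimpleGraph.Adj.reachable ?_⟩
      refine hadj _ _ (orthantGraph_adj_iff.2 ⟨i, ?_, fun j hj => ?_⟩)
      · left; simp [hu, hv]
      · simp [hu, hv, hj]
  exact (h0 r hr).symm.trans hpos (h0 t ht)

/-- Successive corners `splice x y n` lie in C^d and share a line of the grid that avoids T. -/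
lemma joinedOff_of_pathAvoids (hd : 0 < d) (hpos : Function.Injective pos)
    (hC : C ⊆ Finset.range B) (hsurj : ∀ p ∈ lineGrid d B C, ∃ v, pos v = p)
    (hadj : ∀ u v, (orthantGraph d).Adj (pos u) (pos v) → G.Adj u v)
    {S : Set V} {T : Finset (Fin d → ℕ)} (hT : ∀ v ∈ S, pos v ∈ T) {x y : Fin d → ℕ}
    (hx : ∀ i, x i ∈ C) (hy : ∀ i, y i ∈ C) (h : PathAvoids T x y) : JoinedOff G pos S x y := by
  have hlt : ∀ c ∈ C, c < B := fun c hc => Finset.mem_range.1 (hC hc)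
  have hmem : ∀ n j, splice x y n j ∈ C := fun n j => by
    unfold splice; split_ifs <;> simp [hx, hy]
  have hline : ∀ i : Fin d, ∀ r < B, ∀ t < B, JoinedOff G pos S
      (Function.update (splice x y i) i r) (Function.update (splice x y i) i t) :=
    fun i r hr t ht => joinedOff_line hpos hsurj hadj hT (fun j _ => hmem i j) (h i) hr ht
  have hstart : splice x y 0 = x := by funext j; simp [splice]
  have key : ∀ n ≤ d, JoinedOff G pos S x (splice x y n) := by
    intro n
    induction n with
    | zero =>
      intro _
      have := hline ⟨0, hd⟩ _ (hlt _ (hx ⟨0, hd⟩)) _ (hlt _ (hx ⟨0, hd⟩))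
      simpa [hstart] using this
    | succ n ih =>
      intro hn
      refine (ih (by omega)).trans hpos ?_
      have := hline ⟨n, hn⟩ _ (hlt _ (hx ⟨n, hn⟩)) _ (hlt _ (hy ⟨n, hn⟩))
      convert this using 1
      · funext j
        by_cases hj : j = ⟨n, hn⟩
        · subst hj; simp [splice]
        · simp [hj]
      · funext j
        by_cases hj : j = ⟨n, hn⟩
        · subst hj; simp [splice]
        · have : (j : ℕ) ≠ n := fun h => hj (Fin.ext h)
          have : (j : ℕ) < n + 1 ↔ (j : ℕ) < n := by omega
          simp [hj, splice, this]
  have hend : splice x y d = y := by funext j; simp [splice]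
  simpa [hend] using key d le_rfl

lemma ncard_supp_le_largestComponentCard [Finite V] (c : G.ConnectedComponent) :
    c.supp.ncard ≤ largestComponentCard G :=
  le_ciSup (f := fun c : G.ConnectedComponent => c.supp.ncard) (Set.finite_range _).bddAbove c

/-- After deleting `S` from the line grid, one component contains all but `O(|S| B)` vertices. -/
theorem card_le_largestComponentCard_add [Finite V] (hd : 0 < d) (hpos : Function.Injective pos)
    (hC0 : C.Nonempty) (hC : C ⊆ Finset.range B)
    (hsurj : ∀ p ∈ lineGrid d B C, ∃ v, pos v = p)
    (hadj : ∀ u v, (orthantGraph d).Adj (pos u) (pos v) → G.Adj u v) (S : Set V) :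
    (lineGrid d B C).card ≤
      largestComponentCard (G.induce Sᶜ) + (d + d ^ 2) * S.ncard * B := by
  classical
  have hSf : S.Finite := Set.toFinite S
  set T : Finset (Fin d → ℕ) := hSf.toFinset.image pos
  have hT : ∀ v ∈ S, pos v ∈ T := fun v hv => Finset.mem_image_of_mem _ (by simpa using hv)
  have hTc : T.card = S.ncard := by
    rw [Finset.card_image_of_injective _ hpos, Set.ncard_eq_toFinset_card S hSf]
  obtain ⟨x, hx, hxc⟩ := exists_card_not_pathAvoids_le hC0 T
  rw [Fintype.mem_piFinset] at hx
  set R := (lineGrid d B C).filter fun p => JoinedOff G pos S x p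
  have hbound := card_lineGrid_sdiff_le hC0 T hxc (R := R) (by
    intro v i t hvi hvj hl ht hp
    refine Finset.mem_filter.2 ⟨mem_lineGrid_of hvi hvj, ?_⟩
    have h1 := joinedOff_of_pathAvoids hd hpos hC hsurj hadj hT hx (fun j => by
      by_cases hj : j = i
      · subst hj; simpa using ht
      · simpa [hj] using hvj j hj) hp
    have h2 := joinedOff_line hpos hsurj hadj hT hvj hl (Finset.mem_range.1 (hC ht)) hvi
    simpa using h1.trans hpos h2)
  rw [hTc] at hbound
  have hRc : R.card ≤ largestComponentCard (G.induce Sᶜ) := by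
    rcases R.eq_empty_or_nonempty with h | ⟨p, hp⟩
    · simp [h]
    obtain ⟨-, u, -, hu, -, -⟩ := Finset.mem_filter.1 hp
    refine le_trans ?_ (ncard_supp_le_largestComponentCard ((G.induce Sᶜ).connectedComponentMk u))
    rw [← Set.ncard_coe_finset, ← Set.ncard_image_of_injective
      (f := fun w : (Sᶜ : Set V) => pos w) _ (hpos.comp Subtype.val_injective)]
    refine Set.ncard_le_ncard (fun q hq => ?_) (Set.toFinite _)
    obtain ⟨-, u', w, hu', hw, h⟩ := Finset.mem_filter.1 (Finset.mem_coe.1 hq)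
    obtain rfl : u = u' := Subtype.ext (hpos (hu.trans hu'.symm))
    exact ⟨w, SimpleGraph.ConnectedComponent.sound h.symm, hw⟩
  have := Finset.card_le_card_sdiff_add_card (s := lineGrid d B C) (t := R)
  omega

/-- A minimal S leaves components of at most ε|V| vertices, so at least (1 - ε)|V| vertices are
among the (d + d²)|S|B exceptional ones; B then cancels. -/
theorem le_cutSize_of_lineGrid [Finite V] (hd : 0 < d) (hB : 0 < B)
    (hpos : Function.Injective pos) (hC0 : C.Nonempty) (hC : C ⊆ Finset.range B)
    (hrange : Set.range pos = lineGrid d B C)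
    (hadj : ∀ u v, (orthantGraph d).Adj (pos u) (pos v) → G.Adj u v) {ε : ℝ} (hε0 : 0 ≤ ε)
    (hε1 : ε < 1) :
    (1 - ε) * (C.card : ℝ) ^ (d - 1) ≤ (d + d ^ 2) * (cutSize ε G : ℝ) := by
  have hcard : Nat.card V = (lineGrid d B C).card := by
    rw [← Set.ncard_coe_finset, ← hrange, ← Set.image_univ, Set.ncard_image_of_injective _ hpos,
      Set.ncard_univ]
  have hne : {s : ℕ | ∃ S : Set V, S.ncard = s ∧
      (largestComponentCard (G.induce Sᶜ) : ℝ) ≤ ε * (Nat.card V : ℝ)}.Nonempty := by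
    refine ⟨_, Set.univ, rfl, le_trans (le_of_eq ?_) (by positivity : (0 : ℝ) ≤ _)⟩
    rw [Nat.cast_eq_zero]
    refine Nat.le_zero.1 (ciSup_le' fun c => ?_)
    obtain ⟨u, -⟩ := c.exists_rep
    exact absurd (Set.mem_univ _) u.2
  obtain ⟨S, hS, hL⟩ := Nat.sInf_mem hne
  rw [show sInf _ = cutSize ε G from rfl] at hS
  have h1 := card_le_largestComponentCard_add hd hpos hC0 hC
    (fun p hp => by rw [← Finset.mem_coe, ← hrange] at hp; exact hp) hadj S
  have h1' : ((lineGrid d B C).card : ℝ) ≤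
      largestComponentCard (G.induce Sᶜ) + (d + d ^ 2) * (cutSize ε G : ℝ) * B := by
    rw [← hS]; exact_mod_cast h1
  have h2 : (B : ℝ) * (C.card : ℝ) ^ (d - 1) ≤ (lineGrid d B C).card := by
    exact_mod_cast le_card_lineGrid (B := B) (C := C) hd
  rw [hcard] at hL
  have hB' : (0 : ℝ) < B := by exact_mod_cast hB
  refine le_of_mul_le_mul_right ?_ hB'
  have h3 : (1 - ε) * ((B : ℝ) * (C.card : ℝ) ^ (d - 1)) ≤ (1 - ε) * (lineGrid d B C).card :=
    mul_le_mul_of_nonneg_left h2 (by linarith)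
  linarith

end LowerBound

/-! ### The line grid inside the sponge with m = 1. -/

section Sponge

variable {d b : ℕ} {A : Finset ℕ}

/-- The numbers below `b ^ k` none of whose `k` digits lies in `A`. -/
def avoidingNumbers (b : ℕ) (A : Finset ℕ) (k : ℕ) : Finset ℕ :=
  (Finset.range (b ^ k)).filter fun x => ∀ j < k, x / b ^ j % b ∉ A

lemma mem_avoidingNumbers {k x : ℕ} :
    x ∈ avoidingNumbers b A k ↔ x < b ^ k ∧ ∀ j < k, x / b ^ j % b ∉ A := by
  simp [avoidingNumbers]

lemma mem_avoidingNumbers_succ (hb : 0 < b) {k x : ℕ} :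
    x ∈ avoidingNumbers b A (k + 1) ↔ x / b ∈ avoidingNumbers b A k ∧ x % b ∉ A := by
  rw [mem_avoidingNumbers, mem_avoidingNumbers, Nat.div_lt_iff_lt_mul hb, ← pow_succ]
  simp only [Nat.div_div_eq_div_mul, ← pow_succ']
  constructor
  · rintro ⟨h1, h2⟩
    exact ⟨⟨h1, fun j hj => h2 (j + 1) (by omega)⟩, by simpa using h2 0 (by omega)⟩
  · rintro ⟨⟨h1, h2⟩, h3⟩
    refine ⟨h1, fun j hj => ?_⟩
    rcases j with _ | j
    · simpa using h3
    · exact h2 j (by omega)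

lemma card_avoidingNumbers (hb : 0 < b) (hA : A ⊆ Finset.range b) (k : ℕ) :
    (avoidingNumbers b A k).card = (b - A.card) ^ k := by
  induction k with
  | zero => simp [avoidingNumbers]
  | succ k ih =>
    have h : (avoidingNumbers b A (k + 1)).card =
        (avoidingNumbers b A k ×ˢ (Finset.range b \ A)).card := by
      refine Finset.card_nbij' (fun x => (x / b, x % b)) (fun z => b * z.1 + z.2) ?_ ?_ ?_ ?_
      · intro x hx
        have := (mem_avoidingNumbers_succ hb).1 hx
        simp [this, Nat.mod_lt _ hb]
      · rintro ⟨y, c⟩ hz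
        simp only [Finset.coe_product, Set.mem_prod, Finset.mem_coe, Finset.mem_sdiff,
          Finset.mem_range] at hz
        simp only [Finset.mem_coe]
        rw [mem_avoidingNumbers_succ hb, Nat.mul_add_div hb, Nat.div_eq_of_lt hz.2.1,
          Nat.mul_add_mod, Nat.mod_eq_of_lt hz.2.1]
        exact ⟨hz.1, hz.2.2⟩
      · intro x _
        exact Nat.div_add_mod x b
      · rintro ⟨y, c⟩ hz
        simp only [Finset.coe_product, Set.mem_prod, Finset.mem_coe, Finset.mem_sdiff,
          Finset.mem_range] at hz
        simp only [Nat.mul_add_div hb, Nat.div_eq_of_lt hz.2.1, Nat.mul_add_mod,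
          Nat.mod_eq_of_lt hz.2.1, add_zero]
    rw [h, Finset.card_product, ih, Finset.card_sdiff_of_subset hA, Finset.card_range, pow_succ]

/-- Only the free coordinate can have digits in A, so each position has at most one exception. -/
lemma lineGrid_subset_spongeVerts (k : ℕ) {x : Fin d → ℕ}
    (hx : x ∈ lineGrid d (b ^ k) (avoidingNumbers b A k)) : x ∈ spongeVerts d b A 1 k := by
  obtain ⟨i, hi, hj⟩ := exists_of_mem_lineGrid hx
  refine ⟨fun j => ?_, fun t ht => ?_⟩
  · by_cases h : j = i
    · exact h ▸ hi
    · exact (mem_avoidingNumbers.1 (hj j h)).1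
  · refine (Finset.card_le_card (t := {i}) fun j hjt => ?_).trans (by simp)
    rw [Finset.mem_singleton]
    by_contra h
    exact (mem_avoidingNumbers.1 (hj j h)).2 t ht (Finset.mem_filter.1 hjt).2

lemma spongeN_one : spongeN d b A 1 = (b - A.card) ^ (d - 1) := by simp [spongeN]

/-- Here |C|^(d-1) = N^k, so the line grid has at most d(bN)^k vertices while its cut is of order
N^k. -/
lemma le_sepProfile_sponge (hd : 2 ≤ d) (hb : 0 < b) (hA : A ⊆ Finset.range b)
    (hN : 0 < spongeN d b A 1) {ε : ℝ} (hε0 : 0 ≤ ε) (hε1 : ε < 1) {n k : ℕ}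
    (hn : d * (b * spongeN d b A 1) ^ k ≤ n) :
    (1 - ε) * (spongeN d b A 1 : ℝ) ^ k ≤
      (d + d ^ 2) * (sepProfile ε (sponge d b A 1).coe n : ℝ) := by
  have hpowN : ((avoidingNumbers b A k).card) ^ (d - 1) = spongeN d b A 1 ^ k := by
    rw [card_avoidingNumbers hb hA, spongeN_one, ← pow_mul, ← pow_mul, mul_comm]
  have hβ : 0 < b - A.card := by
    rw [spongeN_one] at hN
    by_contra h
    have h0 : b - A.card = 0 := by omega
    rw [h0, zero_pow (by omega)] at hN
    exact lt_irrefl _ hN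
  set U := lineGrid d (b ^ k) (avoidingNumbers b A k)
  set G : (sponge d b A 1).coe.Subgraph := (⊤ : (sponge d b A 1).coe.Subgraph).induce
    {v | v.1 ∈ U}
  have hverts : G.verts = {v | v.1 ∈ U} := rfl
  have hinj : Function.Injective fun v : (sponge d b A 1).verts => v.1 := Subtype.val_injective
  have himg : (fun v : (sponge d b A 1).verts => v.1) '' G.verts = U := by
    rw [hverts]
    ext x
    constructor
    · rintro ⟨v, hv, rfl⟩
      exact hv
    · intro hx
      exact ⟨⟨x, mem_sponge_verts.2 ⟨k, lineGrid_subset_spongeVerts k hx⟩⟩, hx, rfl⟩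
  have hfin : G.verts.Finite := Set.Finite.of_finite_image (himg ▸ U.finite_toSet) hinj.injOn
  have hcard : G.verts.ncard ≤ n := by
    rw [← Set.ncard_image_of_injective _ hinj, himg, Set.ncard_coe_finset]
    refine card_lineGrid_le.trans (le_trans (le_of_eq ?_) hn)
    rw [hpowN, mul_pow]
  have hF : Finite G.verts := hfin
  have hcut := le_cutSize_of_lineGrid (G := G.coe) (pos := fun v => v.1.1) (B := b ^ k)
    (C := avoidingNumbers b A k) (by omega) (by positivity)
    (Subtype.val_injective.comp Subtype.val_injective)
    (Finset.card_pos.1 (by rw [card_avoidingNumbers hb hA]; positivity))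
    (Finset.filter_subset _ _) (by
      rw [← himg]
      ext x
      simp) (fun u v huv => by
      rw [SimpleGraph.Subgraph.coe_adj, SimpleGraph.Subgraph.induce_adj]
      refine ⟨u.2, v.2, ?_⟩
      rw [SimpleGraph.Subgraph.top_adj, SimpleGraph.Subgraph.coe_adj]
      exact sponge_adj.2 ⟨k, lineGrid_subset_spongeVerts k u.2,
        lineGrid_subset_spongeVerts k v.2, huv⟩) hε0 hε1
  have h2 : ((avoidingNumbers b A k).card : ℝ) ^ (d - 1) = (spongeN d b A 1 : ℝ) ^ k := by
    exact_mod_cast hpowN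
  rw [h2] at hcut
  refine hcut.trans ?_
  have := le_sepProfile hε0 hfin hcard
  gcongr

theorem isBigO_sepProfile (hd : 2 ≤ d) (hb : 1 < b) (hA : A ⊆ Finset.range b)
    (hN : 0 < spongeN d b A 1) {ε : ℝ} (hε0 : 0 ≤ ε) (hε1 : ε < 1) :
    (fun n : ℕ => (n : ℝ) ^ spongeE d b A 1) =O[atTop]
      fun n : ℕ => (sepProfile ε (sponge d b A 1).coe n : ℝ) := by
  set N := spongeN d b A 1
  set E := spongeE d b A 1
  have hE : 0 ≤ E := spongeE_nonneg
  have hbN : 1 < b * N := lt_of_lt_of_le hb (Nat.le_mul_of_pos_right _ hN)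
  refine IsBigO.of_bound ((d : ℝ) ^ E * N * ((d + d ^ 2) / (1 - ε)))
    (eventually_atTop.2 ⟨d, fun n hn => ?_⟩)
  rw [Real.norm_of_nonneg (by positivity), Real.norm_of_nonneg (Nat.cast_nonneg _)]
  -- The largest grid that fits in n vertices; n ≤ d(bN)^(k+1) then loses only the factor d^E N.
  set k := Nat.log (b * N) (n / d)
  have hnd : n / d ≠ 0 := (Nat.div_pos hn (by omega)).ne'
  have h1 : d * (b * N) ^ k ≤ n :=
    (Nat.mul_le_mul_left d (Nat.pow_log_le_self _ hnd)).trans (Nat.mul_div_le n d)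
  have h2 : n ≤ d * (b * N) ^ (k + 1) := by
    have : n / d < (b * N) ^ (k + 1) := Nat.lt_pow_succ_log_self hbN _
    rw [Nat.div_lt_iff_lt_mul (by omega)] at this
    rw [mul_comm]
    exact this.le
  have h3 := le_sepProfile_sponge hd (by omega) hA hN hε0 hε1 h1
  have hε : 0 < 1 - ε := by linarith
  have h4 : (N : ℝ) ^ k ≤ (d + d ^ 2) / (1 - ε) * (sepProfile ε (sponge d b A 1).coe n : ℝ) := by
    rw [div_mul_eq_mul_div, le_div_iff₀ hε, mul_comm]
    exact h3
  calc (n : ℝ) ^ E ≤ ((d * (b * N) ^ (k + 1) : ℕ) : ℝ) ^ E := by gcongr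
    _ = (d : ℝ) ^ E * (N : ℝ) ^ (k + 1) := by
      rw [Nat.cast_mul, Real.mul_rpow (by positivity) (by positivity), pow_rpow_spongeE hb hN]
    _ = (d : ℝ) ^ E * N * (N : ℝ) ^ k := by ring
    _ ≤ (d : ℝ) ^ E * N * ((d + d ^ 2) / (1 - ε) * (sepProfile ε (sponge d b A 1).coe n : ℝ)) := by
      gcongr
    _ = _ := by ring

lemma spongeE_one (hd : 1 ≤ d) (hA : A ⊆ Finset.range b) :
    spongeE d b A 1 = ((d : ℝ) - 1) * Real.log ((b : ℝ) - A.card) /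
        (((d : ℝ) - 1) * Real.log ((b : ℝ) - A.card) + Real.log b) := by
  have hc : A.card ≤ b := by simpa using Finset.card_le_card hA
  rw [spongeE, spongeN_one, Nat.cast_pow, Real.log_pow, Nat.cast_sub hc, Nat.cast_sub hd,
    Nat.cast_one]

end Sponge

theorem theorem2 (d b m : ℕ) (A : Finset ℕ) (hd : 2 ≤ d) (hb : 3 ≤ b)
    (hA : A ⊆ Finset.range b) (hm : m ≤ d) (hN : 0 < spongeN d b A m)
    (ε : ℝ) (hε0 : 0 < ε) (hε1 : ε < 1) :
    ((fun n : ℕ => (sepProfile ε (sponge d b A m).coe n : ℝ)) =O[atTop]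
        fun n : ℕ => (n : ℝ) ^ spongeE d b A m) ∧
    (m = 1 →
      spongeE d b A m = ((d : ℝ) - 1) * Real.log ((b : ℝ) - A.card) /
        (((d : ℝ) - 1) * Real.log ((b : ℝ) - A.card) + Real.log b) ∧
      (fun n : ℕ => (sepProfile ε (sponge d b A m).coe n : ℝ)) =Θ[atTop]
        fun n : ℕ => (n : ℝ) ^ spongeE d b A m) := by
  have hO := sepProfile_isBigO (by omega) (by omega : 1 < b) hA hN hε0
  refine ⟨hO, ?_⟩
  rintro rfl
  exact ⟨spongeE_one (by omega) hA, hO,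
    isBigO_sepProfile hd (by omega) hA hN hε0.le hε1⟩
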